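/- Let $k$ be an algebraically closed field and let $\mathbf{C}$ be a finite length category over $k$, that is, an essentially small $k$-linear abelian category in which every object has finite length and all morphism spaces are finite dimensional. Let $\Lambda$ be a set labelling the isomorphism classes of simple objects, $\lambda\mapsto L(\lambda)$. For $\Omega\subseteq\Lambda$ let $\mathbf{C}_\Omega$ be the Serre subcategory of $\mathbf{C}$ generated by the $L(\lambda)$, $\lambda\in\Omega$. Let $I(\lambda)$ be the injective hull of $L(\lambda)$ in $\mathrm{Ind}\,\mathbf{C}$, and let $\Gamma_\Omega:\mathrm{Ind}\,\mathbf{C}\to\mathrm{Ind}\,\mathbf{C}_\Omega$ be the right adjoint of the inclusion. Let $\le$ be a partial order on $\Lambda$ which is lower finite: for each $\lambda$ the set ${\le}\lambda:=\{\mu\in\Lambda: \mu\le\lambda\}$ is finite. An ideal in $\Lambda$ is a subset closed under passing to smaller elements. Assume that $(\mathbf{C},\le)$ is a lower finite highest weight category, meaning that at least one of the following (equivalent) systems of conditions holds for all $\lambda\in\Lambda$. Version $\ast$: (i) $\mathbf{C}_{\le\lambda}$ is a finite category, i.e. a finite length category with an object $G$ such that every full additive subcategory containing $G$ and closed under subquotients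 is the whole category; (ii) $\nabla(\lambda):=\Gamma_{\le\lambda}I(\lambda)$ belongs to $\mathbf{C}_{\le\lambda}$ and $[\nabla(\lambda):L(\lambda)]=1$; (iii) $I(\lambda)$ is the union (direct limit) of a directed set of subobjects, each of which has a finite filtration with each quotient isomorphic to $\nabla(\mu)$ for some $\mu\ge\lambda$ (in particular it lies in $\mathbf{C}$). Version $\dagger$: (i) $L(\lambda)$ has an injective hull $\nabla(\lambda)$ and a projective cover $\Delta(\lambda)$ in $\mathbf{C}_{\le\lambda}$; (ii) $[\nabla(\lambda):L(\lambda)]=1$, and $\nabla(\lambda)$ is injective in $\mathbf{C}_\Omega$ for every finite ideal $\Omega\ni\lambda$ in which $\lambda$ is maximal; (iii) $\mathrm{Ext}^2_{\mathbf{C}}(\Delta(\lambda),\nabla(\mu))=0$ for every $\mu\in\Lambda$. Then for every finite ideal $\Omega\subseteq\Lambda$ the subcategory $\mathbf{C}_\Omega$ is extension full in $\mathbf{C}$: for all $M,N\in\mathbf{C}_\Omega$ and all integers $d\ge 0$, the homomorphism $$\mathrm{Ext}^d_{\mathbf{C}_\Omega}(M,N)\to\mathrm{Ext}^d_{\mathbf{C}}(M,N)$$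 induced by the exact inclusion $\mathbf{C}_\Omega\to\mathbf{C}$ is bijective. -/

import Mathlib

open CategoryTheory CategoryTheory.Limits

universe w v u

namespace HWCat

/-! ### Abelian subcategories and extension fullness -/

section Subcategories

variable {C : Type u} [Category.{v} C] [Abelian C]

theorem preservesFiniteLimits_subcategory (P : ObjectProperty C) [P.ContainsZero]
    [P.IsClosedUnderKernels] [P.IsClosedUnderCokernels] [P.IsClosedUnderFiniteProducts] :
    PreservesFiniteLimits P.ι := by
  have := P.preservesKernels_ι
  exact P.ι.preservesFiniteLimits_of_preservesKernels

theorem preservesFiniteColimits_subcategory (P : ObjectProperty C) [P.ContainsZero]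
    [P.IsClosedUnderKernels] [P.IsClosedUnderCokernels] [P.IsClosedUnderFiniteProducts] :
    PreservesFiniteColimits P.ι := by
  have := P.preservesCokernels_ι
  exact P.ι.preservesFiniteColimits_of_preservesCokernels

/-- Let `P` be an abelian subcategory of `C` (a full subcategory which contains zero and is closed
under finite direct sums, kernels and cokernels of `C`). It is extension full in `C` if for all
objects `M`, `N` of `P` and all `d`, the homomorphism from the `d`-th extension group of `M` and `N`
in `P` to the one in `C`, induced by the exact inclusion functor, is bijective. -/
def ExtensionFull (P : ObjectProperty C) [P.ContainsZero]
    [P.IsClosedUnderKernels] [P.IsClosedUnderCokernels] [P.IsClosedUnderFiniteProducts] : Prop :=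
  haveI := preservesFiniteLimits_subcategory P
  haveI := preservesFiniteColimits_subcategory P
  haveI := HasExt.standard C
  haveI := HasExt.standard P.FullSubcategory
  ∀ (M N : P.FullSubcategory) (d : ℕ), Function.Bijective (P.ι.mapExtAddHom M N d)

/-- The Serre subcategory generated by a family of objects: the smallest Serre
subcategory which contains `L a` for every `a ∈ Ω`. -/
def serreSub {Λ : Type w} (L : Λ → C) (Ω : Set Λ) : ObjectProperty C :=
  fun X => ∀ P : ObjectProperty C, P.IsSerreClass → (∀ a ∈ Ω, P (L a)) → P X

instance serreSub_isSerreClass {Λ : Type w} (L : Λ → C) (Ω : Set Λ) :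
    (serreSub L Ω).IsSerreClass where
  exists_zero := ⟨_, isZero_zero C, fun P _ _ => P.prop_of_isZero (isZero_zero C)⟩
  prop_of_mono f _ h P hP hL := P.prop_of_mono f (h P hP hL)
  prop_of_epi f _ h P hP hL := P.prop_of_epi f (h P hP hL)
  prop_X₂_of_shortExact hS h₁ h₃ P hP hL :=
    P.prop_X₂_of_shortExact hS (h₁ P hP hL) (h₃ P hP hL)

theorem isClosedUnderFiniteProducts_of_extensions (P : ObjectProperty C) [P.ContainsZero]
    [P.IsClosedUnderIsomorphisms] [P.IsClosedUnderExtensions] :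
    P.IsClosedUnderFiniteProducts := by
  have : P.IsClosedUnderBinaryProducts := ⟨by
    rintro X ⟨p⟩
    let A := p.diag.obj ⟨WalkingPair.left⟩
    let B := p.diag.obj ⟨WalkingPair.right⟩
    have h : P (A ⊞ B) :=
      P.prop_X₂_of_shortExact (ShortComplex.Splitting.ofHasBinaryBiproduct A B).shortExact
        (p.prop_diag_obj _) (p.prop_diag_obj _)
    have e : (A ⊞ B) ≅ X :=
      (biprod.isoProd A B) ≪≫ (HasLimit.isoOfNatIso (diagramIsoPair p.diag)).symm ≪≫
        (limit.isLimit p.diag).conePointUniqueUpToIso p.isLimit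
    exact P.prop_of_iso e h⟩
  exact ObjectProperty.IsClosedUnderFiniteProducts.mk'

instance serreSub_isClosedUnderFiniteProducts {Λ : Type w} (L : Λ → C) (Ω : Set Λ) :
    (serreSub L Ω).IsClosedUnderFiniteProducts :=
  isClosedUnderFiniteProducts_of_extensions _

end Subcategories

/-! ### Finite filtrations, finite length categories and finite categories -/

section FiniteLength

variable {C : Type u} [Category.{v} C] [Abelian C]

/-- `HasFiltration X l`: the object `X` has a finite filtration
`0 = X₀ ⊂ X₁ ⊂ ⋯ ⊂ Xₙ = X` with successive quotients (from the top down) the members of the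
list `l`, up to isomorphism. -/
inductive HasFiltration : C → List C → Prop
  | zero (X : C) (hX : IsZero X) : HasFiltration X []
  | step (S : ShortComplex C) (hS : S.ShortExact) (l : List C) (h : HasFiltration S.X₁ l) :
      HasFiltration S.X₂ (S.X₃ :: l)

/-- `HasCompositionSeries X l`: the object `X` has a finite composition series with list of
composition factors `l`. -/
def HasCompositionSeries (X : C) (l : List C) : Prop :=
  HasFiltration X l ∧ ∀ T ∈ l, Simple T

open Classical in
/-- `HasMultiplicity X T n`: the equality `[X : T] = n`, that is, the object `X` has a finite
composition series with exactly `n` factors isomorphic to the simple object `T`. -/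
def HasMultiplicity (X T : C) (n : ℕ) : Prop :=
  ∃ l : List C, HasCompositionSeries X l ∧ l.countP (fun Y => Nonempty (Y ≅ T)) = n

variable (k : Type w) [Field k]

/-- A finite length category over the field `k`: an essentially small `k`-linear abelian category
in which all objects have finite length and all morphism spaces are finite dimensional. -/
structure IsFiniteLengthCategory (C : Type u) [Category.{v} C] [Abelian C] [Linear k C] :
    Prop where
  essentiallySmall : EssentiallySmall.{v} C
  finite_length : ∀ X : C, ∃ l : List C, HasCompositionSeries X l
  finite_hom : ∀ X Y : C, Module.Finite k (X ⟶ Y)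

/-- A topologising subcategory: a full additive subcategory closed under subquotients. -/
structure IsTopologising (P : ObjectProperty C) : Prop where
  containsZero : P.ContainsZero
  finiteProducts : P.IsClosedUnderFiniteProducts
  subobjects : P.IsClosedUnderSubobjects
  quotients : P.IsClosedUnderQuotients

/-- A finite category over `k`: a finite length category with an object `G` such that the
topologising subcategory generated by `G` is the whole category. -/
structure IsFiniteCategory (C : Type u) [Category.{v} C] [Abelian C] [Linear k C] :
    Prop where
  finiteLength : IsFiniteLengthCategory k C
  exists_generator : ∃ G : C, ∀ P : ObjectProperty C, IsTopologising P → P G → ∀ X : C, P X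

end FiniteLength

/-! ### Injective hulls and projective covers -/

section Hulls

variable {C : Type u} [Category.{v} C]

/-- `i : X ⟶ I` is an injective hull of `X`: an essential monomorphism into an injective object. -/
structure IsInjectiveHull {X I : C} (i : X ⟶ I) : Prop where
  injective : Injective I
  mono : Mono i
  essential : ∀ ⦃Z : C⦄ (g : I ⟶ Z), Mono (i ≫ g) → Mono g

/-- `p : Q ⟶ X` is a projective cover of `X`: a superfluous (essential) epimorphism from a
projective object. -/
structure IsProjectiveCover {Q X : C} (p : Q ⟶ X) : Prop where
  projective : Projective Q
  epi : Epi p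
  superfluous : ∀ ⦃Z : C⦄ (g : Z ⟶ Q), Epi (g ≫ p) → Epi g

/-- The object `I` belongs to the full subcategory `P` and is injective as an object of `P`. -/
def IsInjectiveIn (P : ObjectProperty C) (I : C) : Prop :=
  ∃ hI : P I, Injective (⟨I, hI⟩ : P.FullSubcategory)

/-- `X` and `I` belong to the full subcategory `P`, and `I` is an injective hull of `X` in `P`. -/
def IsInjectiveHullIn (P : ObjectProperty C) (X I : C) : Prop :=
  ∃ (hX : P X) (hI : P I) (i : (⟨X, hX⟩ : P.FullSubcategory) ⟶ ⟨I, hI⟩), IsInjectiveHull i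

/-- `X` and `Q` belong to the full subcategory `P`, and `Q` is a projective cover of `X` in `P`. -/
def IsProjectiveCoverIn (P : ObjectProperty C) (X Q : C) : Prop :=
  ∃ (hX : P X) (hQ : P Q) (p : (⟨Q, hQ⟩ : P.FullSubcategory) ⟶ ⟨X, hX⟩), IsProjectiveCover p

/-- Let `I` be an object of the ind-completion of `C`. The object `Y` belongs to the full
subcategory `P` of `C` and, via `j : Y ⟶ I`, it is the coreflection `Γ I` of `I`: every
morphism to `I` from an object of `P` factors uniquely through `j`. As every object of `Ind P` is
a filtered colimit of objects of `P`, this says that `Y` is the value at `I` of the right adjoint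
of the inclusion of `Ind P` into `Ind C`. -/
def IsGamma (P : ObjectProperty C) (I : Ind C) (Y : C) : Prop :=
  P Y ∧ ∃ j : Ind.yoneda.obj Y ⟶ I, ∀ M : C, P M →
    Function.Bijective (fun f : M ⟶ Y => Ind.yoneda.map f ≫ j)

end Hulls

/-! ### Lower finite highest weight categories -/

section HighestWeight

variable {C : Type u} [Category.{v} C] [Abelian C] {Λ : Type w}

/-- `Λ` labels the isomorphism classes of simple objects of `C` via `a ↦ L a`. -/
structure LabelsSimples (L : Λ → C) : Prop where
  simple : ∀ a, Simple (L a)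
  eq_of_iso : ∀ a b, Nonempty (L a ≅ L b) → a = b
  exists_iso : ∀ X : C, Simple X → ∃ a, Nonempty (X ≅ L a)

variable [PartialOrder Λ]

/-- The object `X` of `C` has a finite filtration in which each quotient is isomorphic to `N b`
for some `b ≥ a`. -/
def HasFlagAbove (N : Λ → C) (a : Λ) (X : C) : Prop :=
  ∃ l : List C, HasFiltration X l ∧ ∀ T ∈ l, ∃ b, a ≤ b ∧ Nonempty (T ≅ N b)

/-- The object `I` of the ind-completion of `C` is the union of a directed set of subobjects,
each of which is an object of `C` with a finite filtration with quotients `N b` for `b ≥ a`. -/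
def IsUnionOfFlagsAbove (N : Λ → C) (a : Λ) (I : Ind C) : Prop :=
  ∃ (J : Type v) (_ : PartialOrder J) (_ : IsDirectedOrder J) (_ : Nonempty J)
    (F : J ⥤ C) (s : F ⋙ Ind.yoneda ⟶ (Functor.const J).obj I),
    Nonempty (IsColimit (Cocone.mk I s)) ∧ (∀ j, Mono (s.app j)) ∧
      ∀ j, HasFlagAbove N a (F.obj j)

/-- The conditions for a lower finite highest weight category in terms of the injective hulls
`I a` of the simple objects `L a` in the ind-completion, with costandard objects
`N a = Γ (I a)`, where `Γ` is taken with respect to the weights `≤ a`. -/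
structure IsLFHWStarWith (k : Type*) [Field k] [Linear k C] (L : Λ → C) (N : Λ → C)
    (I : Λ → Ind C) : Prop where
  injectiveHull : ∀ a, ∃ i : Ind.yoneda.obj (L a) ⟶ I a, IsInjectiveHull i
  finite : ∀ a, IsFiniteCategory k (serreSub L (Set.Iic a)).FullSubcategory
  gamma : ∀ a, IsGamma (serreSub L (Set.Iic a)) (I a) (N a)
  multiplicity_one : ∀ a, HasMultiplicity (N a) (L a) 1
  union_of_flags : ∀ a, IsUnionOfFlagsAbove N a (I a)

/-- The conditions for a lower finite highest weight category in terms of the costandard objects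
`N a` and standard objects `D a`, which are the injective hull and the projective cover of `L a`
in the Serre subcategory for the weights `≤ a`. -/
structure IsLFHWDaggerWith (L : Λ → C) (N D : Λ → C) : Prop where
  injectiveHull : ∀ a, IsInjectiveHullIn (serreSub L (Set.Iic a)) (L a) (N a)
  projectiveCover : ∀ a, IsProjectiveCoverIn (serreSub L (Set.Iic a)) (L a) (D a)
  multiplicity_one : ∀ a, HasMultiplicity (N a) (L a) 1
  injective : ∀ (a : Λ) (Ω : Set Λ), Ω.Finite → IsLowerSet Ω → Maximal (· ∈ Ω) a →
    IsInjectiveIn (serreSub L Ω) (N a)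
  ext_two : haveI := HasExt.standard C
    ∀ a b, Subsingleton (Abelian.Ext (D a) (N b) 2)

/-- Lower finite highest weight categories: the order on the set `Λ` of weights is lower finite,
and one of the two systems of conditions is satisfied. -/
structure IsLFHW (k : Type*) [Field k] [Linear k C] (L : Λ → C) : Prop where
  lowerFinite : ∀ a : Λ, (Set.Iic a).Finite
  conditions : (∃ (N : Λ → C) (I : Λ → Ind C), IsLFHWStarWith k L N I) ∨
    (∃ N D : Λ → C, IsLFHWDaggerWith L N D)

end HighestWeight

end HWCat

-- Extension fullness follows by dimension shifting once every object of $\mathbf{C}_\Omega$ embeds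
-- in an object $I\in\mathbf{C}_\Omega$ with $\mathrm{Ext}^{d}_{\mathbf{C}}(M,I)=0$ for all
-- $M\in\mathbf{C}_\Omega$, $d>0$ (`extensionFull_of_enough_acyclic`). Both versions of the axioms
-- enter only through `StandardData`: $\nabla(a)/L(a)$ has weights below $a$,
-- $\mathrm{Ext}^1(L(b),\nabla(a))=0$ unless $a<b$, and $\mathrm{Ext}^1$, $\mathrm{Ext}^2$ from
-- every $\Delta(b)$ to every $\nabla(a)$ vanish.
--
-- Call $I$ acyclic up to $\Omega$ if $\mathrm{Ext}^1(L(a),I)=0$ for $a\in\Omega$ and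
-- $\mathrm{Ext}^1$, $\mathrm{Ext}^2$ from all $\Delta(b)$ to $I$ vanish. Such an $I$ can be
-- enlarged to a $J$ acyclic up to a bigger finite ideal, with $J/I$ filtered by objects $\nabla(a)$
-- for the new weights $a$ (`IsAcyclicUpTo.exists_insert`, `IsAcyclicUpTo.exists_of_subset`). Two
-- consequences follow.
--
-- Higher vanishing (`IsAcyclicUpTo.ext_eq_zero`): a class in $\mathrm{Ext}^{n+2}(M,I)$ dies under
-- some $I\hookrightarrow Z$. Choose $J\supseteq I$ acyclic also up to the weights of $Z$. Then
-- $I\to J$ extends to $Z$, so the class dies in $J$. But $J/I$ is filtered by $\nabla(a)$ with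
-- $a\notin\Omega$, and $\mathrm{Ext}^{n+1}(M,\nabla(a))=0$ by induction, so the class was already
-- zero.
--
-- Enough acyclic objects (`IsAcyclicUpTo.exists_mono`): enlarge $\nabla(a)$ inside
-- $\mathbf{C}_\Omega$ and induct on a composition series.
--
-- For version $\dagger$ the vanishing is nearly given. For version $\ast$, $\Delta(a)$ exists
-- because finite categories have enough projectives, and the vanishing comes from
-- $\nabla(a)\subseteq I(a)$ and the $\nabla$-flags exhausting $I(a)$.

universe t

namespace HWCat

/-! ### Effaceability of Ext in positive degrees -/

section Effaceability

open HomologicalComplex DerivedCategory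
variable {C : Type u} [Category.{v} C] [Abelian C]

/-- As $L$ vanishes below degree $i$, its $i$-th homology embeds in $L^i$; up to isomorphism the map
is $Y\cong H^i(L)\hookrightarrow L^i$. -/
theorem mono_f_of_quasiIsoAt_of_isStrictlyGE
    {Y : C} {L : CochainComplex C ℤ} {i : ℤ}
    (ι : (single C (ComplexShape.up ℤ) i).obj Y ⟶ L) [L.IsStrictlyGE i] [QuasiIsoAt ι i] :
    Mono ((singleObjXSelf (ComplexShape.up ℤ) i Y).inv ≫ ι.f i) := by
  let e := L.pOpcyclesIso (i - 1) i (by simp)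
    ((L.isZero_of_isStrictlyGE i (i - 1) (by simp)).eq_of_src _ _)
  let α := (singleObjHomologySelfIso _ _ _).inv ≫ homologyMap ι i ≫ L.homologyι i ≫ e.inv
  have h : ι.f i = (singleObjXSelf (ComplexShape.up ℤ) i Y).hom ≫ α := by
    rw [← cancel_mono e.hom]
    dsimp only [α]
    rw [Category.assoc, Category.assoc, Category.assoc, Category.assoc, e.inv_hom_id,
      Category.comp_id, homologyι_naturality, singleObjHomologySelfIso_inv_homologyι_assoc,
      ← pOpcycles_singleObjOpcyclesSelfIso_inv_assoc, Iso.inv_hom_id_assoc, p_opcyclesMap]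
    rfl
  rw [h, Iso.inv_hom_id_assoc]
  have : Mono (homologyMap ι i) := inferInstance
  dsimp only [α]
  infer_instance

/-- Write the morphism as a fraction through a complex $L$ living in degrees $\ge i$ and take
$Z=L^i$. Projecting $L$ to its lowest term kills the numerator, since $K^i=0$. -/
theorem exists_mono_comp_eq_zero_of_derived [HasDerivedCategory.{w} C] {Y : C}
    {K : CochainComplex C ℤ} {i : ℤ}
    (φ : Q.obj K ⟶ Q.obj ((single C (ComplexShape.up ℤ) i).obj Y))
    (n : ℤ) (hn : i < n) [K.IsStrictlyGE n] :
    ∃ (Z : C) (j : Y ⟶ Z), Mono j ∧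
      φ ≫ Q.map ((single C (ComplexShape.up ℤ) i).map j) = 0 := by
  have : CochainComplex.IsStrictlyGE ((single C (ComplexShape.up ℤ) i).obj Y) i :=
    inferInstanceAs (((CochainComplex.singleFunctor C i).obj Y).IsStrictlyGE i)
  obtain ⟨L, _, g, ι, h, rfl⟩ := left_fac_of_isStrictlyGE φ i
  have hι : QuasiIso ι := by rwa [isIso_Q_map_iff_quasiIso] at h
  let σ : L ⟶ (single C (ComplexShape.up ℤ) i).obj (L.X i) :=
    mkHomToSingle (𝟙 _) (by
      rintro j rfl
      apply (L.isZero_of_isStrictlyGE (j + 1) j (by simp)).eq_of_src)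
  refine ⟨L.X i, _, mono_f_of_quasiIsoAt_of_isStrictlyGE ι, ?_⟩
  have h₁ : (single C (ComplexShape.up ℤ) i).map
      ((singleObjXSelf (ComplexShape.up ℤ) i Y).inv ≫ ι.f i) = ι ≫ σ := by
    apply to_single_hom_ext
    simp [σ, single_map_f_self]
  have h₂ : g ≫ σ = 0 := by
    apply to_single_hom_ext
    apply (K.isZero_of_isStrictlyGE n i hn).eq_of_src
  rw [h₁, Q.map_comp, Category.assoc, IsIso.inv_hom_id_assoc, ← Q.map_comp, h₂, Q.map_zero]

/-- Extension groups of positive degree are effaceable in the second variable. -/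
theorem exists_mono_comp_mk₀_eq_zero [HasExt.{w} C] {X Y : C} {n : ℕ}
    (e : Abelian.Ext.{w} X Y (n + 1)) :
    ∃ (Z : C) (j : Y ⟶ Z), Mono j ∧ e.comp (Abelian.Ext.mk₀ j) (add_zero _) = 0 := by
  let K := (CochainComplex.singleFunctor C 0).obj X
  -- The target of `e.hom` becomes $Y$ in degree $-(n+1)$, just below the bound $-n$ used for $X$ in
  -- degree $0$.
  have := K.isStrictlyGE_of_ge (-n) 0 (by lia)
  let := HasDerivedCategory.standard C
  let s := ((singleFunctors C).shiftIso (n + 1) (-(n + 1)) 0 (by lia))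
  obtain ⟨Z, j, hj, h⟩ := exists_mono_comp_eq_zero_of_derived (K := K) (n := -n)
    (e.hom ≫ s.hom.app Y) (by lia)
  refine ⟨Z, j, hj, ?_⟩
  apply Abelian.Ext.homEquiv.injective
  rw [← cancel_mono (s.hom.app Z)]
  have hnat := s.hom.naturality j
  change (e.comp (Abelian.Ext.mk₀ j) (add_zero _)).hom ≫ _ =
    (0 : Abelian.Ext X Z (n + 1)).hom ≫ _
  rw [← Abelian.Ext.hom_comp_singleFunctor_map_shift, Abelian.Ext.zero_hom, zero_comp,
    Category.assoc]
  exact (congrArg (e.hom ≫ ·) hnat).trans ((Category.assoc _ _ _).symm.trans h)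

end Effaceability

/-! ### First extension groups as classes of extensions -/

section ExtOne

open Abelian
variable {C : Type u} [Category.{v} C] [Abelian C]

theorem shortExact_pullback {S : ShortComplex C} (hS : S.ShortExact) {M : C} (h : M ⟶ S.X₃) :
    (ShortComplex.mk (pullback.lift S.f 0 (by rw [S.zero, zero_comp]) : S.X₁ ⟶ pullback S.g h)
      (pullback.snd S.g h) (pullback.lift_snd _ _ _)).ShortExact := by
  have := hS.mono_f
  have := hS.epi_g
  have : Mono (pullback.lift S.f 0 (by rw [S.zero, zero_comp]) : S.X₁ ⟶ pullback S.g h) :=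
    mono_of_mono_fac (pullback.lift_fst _ _ _)
  refine ShortComplex.ShortExact.mk' ?_ this (inferInstanceAs (Epi (pullback.snd S.g h)))
  refine ShortComplex.exact_of_f_is_kernel _ (KernelFork.IsLimit.ofι' _ _ fun {A} k hk => ?_)
  dsimp at k hk
  have h₁ : (k ≫ pullback.fst S.g h) ≫ S.g = 0 := by
    rw [Category.assoc, pullback.condition, ← Category.assoc, hk, zero_comp]
  refine ⟨hS.exact.lift _ h₁, ?_⟩
  apply pullback.hom_ext
  · rw [Category.assoc, pullback.lift_fst, hS.exact.lift_f]
  · rw [Category.assoc, pullback.lift_snd, comp_zero, hk]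

variable [HasExt.{w} C]

/-- Efface the class by $u:N\hookrightarrow Z$; it is then the connecting image of some $h:M\to
Z/N$, and pulling back $Z\to Z/N$ along $h$ gives the extension. -/
theorem exists_shortExact_extClass_eq {M N : C} (e : Ext.{w} M N 1) :
    ∃ (E : C) (f : N ⟶ E) (g : E ⟶ M) (z : f ≫ g = 0)
      (h : (ShortComplex.mk f g z).ShortExact), h.extClass = e := by
  obtain ⟨Z, u, _, hu⟩ := exists_mono_comp_mk₀_eq_zero e
  let S := ShortComplex.mk u (cokernel.π u) (cokernel.condition u)
  have hS : S.ShortExact := { exact := ShortComplex.exact_cokernel u }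
  obtain ⟨x, hx⟩ := Ext.covariant_sequence_exact₁ M hS e hu (zero_add 1)
  obtain ⟨h, rfl⟩ := (Ext.mk₀_bijective _ _).2 x
  refine ⟨_, _, _, _, shortExact_pullback hS h, ?_⟩
  let φ : ShortComplex.mk (pullback.lift S.f 0 (by rw [S.zero, zero_comp]) : S.X₁ ⟶ pullback S.g h)
      (pullback.snd S.g h) (pullback.lift_snd _ _ _) ⟶ S :=
    { τ₁ := 𝟙 _, τ₂ := pullback.fst _ _, τ₃ := h,
      comm₁₂ := (Category.id_comp _).trans (pullback.lift_fst _ _ _).symm,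
      comm₂₃ := pullback.condition }
  have := ShortComplex.ShortExact.extClass_naturality (shortExact_pullback hS h) hS φ
  rw [← hx, ← this]
  exact (Ext.comp_mk₀_id _).symm

theorem ext_one_eq_zero_of_section {M N : C}
    (H : ∀ (E : C) (f : N ⟶ E) (g : E ⟶ M) (z : f ≫ g = 0),
      (ShortComplex.mk f g z).ShortExact → ∃ s : M ⟶ E, s ≫ g = 𝟙 M)
    (e : Ext.{w} M N 1) : e = 0 := by
  obtain ⟨E, f, g, z, h, rfl⟩ := exists_shortExact_extClass_eq e
  obtain ⟨s, hs⟩ := H E f g z h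
  have := h.comp_extClass
  rw [← Ext.mk₀_id_comp h.extClass]
  change (Ext.mk₀ (𝟙 M)).comp h.extClass _ = 0
  rw [← hs, ← Ext.mk₀_comp_mk₀, Ext.comp_assoc_of_second_deg_zero]
  erw [this]
  rw [Ext.comp_zero]

theorem ext_one_eq_zero_of_retraction {M N : C}
    (H : ∀ (E : C) (f : N ⟶ E) (g : E ⟶ M) (z : f ≫ g = 0),
      (ShortComplex.mk f g z).ShortExact → ∃ r : E ⟶ N, f ≫ r = 𝟙 N)
    (e : Ext.{w} M N 1) : e = 0 := by
  obtain ⟨E, f, g, z, h, rfl⟩ := exists_shortExact_extClass_eq e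
  obtain ⟨r, hr⟩ := H E f g z h
  have := h.extClass_comp
  rw [← Ext.comp_mk₀_id h.extClass]
  change h.extClass.comp (Ext.mk₀ (𝟙 N)) _ = 0
  rw [← hr, ← Ext.mk₀_comp_mk₀, ← Ext.comp_assoc_of_second_deg_zero]
  erw [this]
  rw [Ext.zero_comp]

/-- A morphism from the first term of a short exact sequence extends to the middle term if the
extension group which contains the obstruction vanishes. -/
theorem exists_extension_of_ext_one {S : ShortComplex C} (hS : S.ShortExact) {J : C}
    (H : ∀ e : Ext.{w} S.X₃ J 1, e = 0) (f : S.X₁ ⟶ J) : ∃ g : S.X₂ ⟶ J, S.f ≫ g = f := by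
  obtain ⟨x, hx⟩ := Ext.contravariant_sequence_exact₁ hS J (Ext.mk₀ f) (add_zero 1) (H _)
  obtain ⟨g, rfl⟩ := (Ext.mk₀_bijective _ _).2 x
  refine ⟨g, (Ext.mk₀_bijective _ _).1 ?_⟩
  rwa [Ext.mk₀_comp_mk₀] at hx

theorem ext_eq_zero_of_shortExact_left {S : ShortComplex C} (hS : S.ShortExact) {J : C} {n : ℕ}
    (h₁ : ∀ e : Ext.{w} S.X₁ J n, e = 0) (h₃ : ∀ e : Ext.{w} S.X₃ J n, e = 0)
    (e : Ext.{w} S.X₂ J n) : e = 0 := by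
  obtain ⟨x, rfl⟩ := Ext.contravariant_sequence_exact₂ hS J e (h₁ _)
  rw [h₃ x, Ext.comp_zero]

theorem ext_eq_zero_of_shortExact_right {S : ShortComplex C} (hS : S.ShortExact) {M : C} {n : ℕ}
    (h₁ : ∀ e : Ext.{w} M S.X₁ n, e = 0) (h₃ : ∀ e : Ext.{w} M S.X₃ n, e = 0)
    (e : Ext.{w} M S.X₂ n) : e = 0 := by
  obtain ⟨x, rfl⟩ := Ext.covariant_sequence_exact₂ M hS e (h₃ _)
  rw [h₁ x, Ext.zero_comp]

end ExtOne

/-! ### Criterion for extension fullness -/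

section ExtensionFull

open Abelian
variable {C : Type u} [Category.{v} C] [Abelian C]

/-- An abelian subcategory is extension full if each of its objects embeds in an object of the
subcategory which is acyclic for the extension groups of the ambient category. -/
theorem extensionFull_of_enough_acyclic (P : ObjectProperty C) [P.ContainsZero]
    [P.IsClosedUnderKernels] [P.IsClosedUnderCokernels] [P.IsClosedUnderFiniteProducts]
    (H : ∀ N, P N → ∃ (I : C) (i : N ⟶ I), Mono i ∧ P I ∧
      ∀ M, P M → ∀ (n : ℕ) (e : letI := HasExt.standard C; Ext M I (n + 1)), e = 0) :
    ExtensionFull P := by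
  have := preservesFiniteLimits_subcategory P
  have := preservesFiniteColimits_subcategory P
  let := HasExt.standard C
  let := HasExt.standard P.FullSubcategory
  change ∀ (M N : P.FullSubcategory) (d : ℕ), Function.Bijective (P.ι.mapExtAddHom M N d)
  intro X Y n
  induction n generalizing Y with
  | zero =>
    rw [Functor.mapExtAddHom_coe, Ext.mapExactFunctor₀]
    simpa using ⟨Functor.Faithful.map_injective, Functor.Full.map_surjective⟩
  | succ n hn =>
    obtain ⟨I, i, hi, hPI, hI⟩ := H Y.obj Y.property
    let I' : P.FullSubcategory := ⟨I, hPI⟩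
    let i' : Y ⟶ I' := P.homMk i
    have hi' : Mono i' := P.ι.mono_of_mono_map hi
    -- Vanishing of first extensions in the ambient category already makes $I$ injective inside the
    -- subcategory.
    have : Injective I' := by
      refine ⟨fun {A B} g f hf => ?_⟩
      let S := ShortComplex.mk _ _ (cokernel.condition f)
      have hS : S.ShortExact := { exact := ShortComplex.exact_cokernel f }
      obtain ⟨h, hh⟩ := exists_extension_of_ext_one (hS.map_of_exact P.ι) (J := I)
        (hI _ (S.X₃).property 0) g.hom
      exact ⟨P.homMk h, P.ι.map_injective hh⟩
    let S := ShortComplex.mk _ _ (cokernel.condition i')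
    have hS : S.ShortExact := { exact := ShortComplex.exact_cokernel i' }
    have hS' : (S.map P.ι).ShortExact := hS.map_of_exact P.ι
    -- Compare the right exact rows
    -- $\mathrm{Ext}^n(X,I)\to\mathrm{Ext}^n(X,I/Y)\to\mathrm{Ext}^{n+1}(X,Y)\to 0$ in the two
    -- categories.
    refine AddMonoidHom.bijective_of_surjective_of_bijective_of_right_exact _ _ _ _
      (P.ι.mapExtAddHom X S.X₂ n) (P.ι.mapExtAddHom X S.X₃ n) (P.ι.mapExtAddHom X S.X₁ (n + 1))
      ?_ ?_
      ((ShortComplex.ab_exact_iff_function_exact _).mp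
        (Ext.covariant_sequence_exact₃' X hS n (n + 1) rfl))
      ((ShortComplex.ab_exact_iff_function_exact _).mp
        (Ext.covariant_sequence_exact₃' (P.ι.obj X) hS' n (n + 1) rfl))
      (hn _).surjective (hn _)
      (fun x₁ ↦ Ext.covariant_sequence_exact₁ _ hS x₁ (Ext.eq_zero_of_injective _) rfl)
      (fun y₁ ↦ Ext.covariant_sequence_exact₁ _ hS' y₁ (hI _ X.property _ _) rfl)
    · ext x
      refine ((Ext.mapExactFunctor_comp P.ι x (Ext.mk₀ S.g) (add_zero n)).trans ?_).symm
      rw [Ext.mapExactFunctor_mk₀]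
      rfl
    · ext x
      refine ((Ext.mapExactFunctor_comp P.ι x hS.extClass rfl).trans ?_).symm
      rw [Ext.mapExactFunctor_extClass]
      rfl

end ExtensionFull

/-! ### Filtrations with simple quotients -/

section CompositionSeries

variable {C : Type u} [Category.{v} C] [Abelian C]

theorem HasFiltration.of_iso {X Y : C} {l : List C} (h : HasFiltration X l) (e : X ≅ Y) :
    HasFiltration Y l := by
  cases h with
  | zero _ hX => exact .zero _ (hX.of_iso e.symm)
  | step S hS l h =>
    let S' := ShortComplex.mk (S.f ≫ e.hom) (e.inv ≫ S.g) (by simp)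
    have hS' : S'.ShortExact :=
      ShortComplex.shortExact_of_iso
        (ShortComplex.isoMk (S₁ := S) (S₂ := S') (Iso.refl _) e (Iso.refl _)
          (by simp [S']) (by simp [S'])) hS
    exact .step S' hS' l h

theorem HasFiltration.append {A X B : C} (f : A ⟶ X) (g : X ⟶ B) (z : f ≫ g = 0)
    (hS : (ShortComplex.mk f g z).ShortExact) {l₁ l₃ : List C}
    (h₁ : HasFiltration A l₁) (h₃ : HasFiltration B l₃) : HasFiltration X (l₃ ++ l₁) := by
  induction h₃ generalizing X with
  | zero B hB =>
    have : IsIso f := by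
      have := hS.mono_f
      have : Epi f := hS.exact.epi_f (hB.eq_of_tgt _ _)
      exact isIso_of_mono_of_epi f
    exact h₁.of_iso (asIso f)
  | step T hT l h ih =>
    have := hT.mono_f
    have := hT.epi_g
    have : Epi g := hS.epi_g
    have h₂ := ih _ (pullback.snd g T.f) _ (shortExact_pullback hS T.f)
    let U := ShortComplex.mk (pullback.fst g T.f) (g ≫ T.g) (by
      rw [pullback.condition_assoc, T.zero, comp_zero])
    have hU : U.ShortExact := by
      have : Epi U.g := inferInstanceAs (Epi (g ≫ T.g))
      have : Mono U.f := inferInstanceAs (Mono (pullback.fst g T.f))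
      refine ShortComplex.ShortExact.mk' ?_ ‹_› ‹_›
      refine ShortComplex.exact_of_f_is_kernel _ (KernelFork.IsLimit.ofι' _ _ fun {W} k hk => ?_)
      have hk' : (k ≫ g) ≫ T.g = 0 := by simpa [U] using hk
      exact ⟨pullback.lift k (hT.exact.lift _ hk') (hT.exact.lift_f _ hk').symm,
        pullback.lift_fst _ _ _⟩
    exact .step U hU _ h₂

/-- The short exact sequence of quotients by a subobject of the first term. -/
theorem exists_shortExact_cokernel {S : ShortComplex C} (hT : S.ShortExact) {A B : C}
    (f' : A ⟶ S.X₁) (g : S.X₂ ⟶ B) {f : A ⟶ S.X₂} (hf' : f' ≫ S.f = f) (z : f ≫ g = 0)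
    (hS : (ShortComplex.mk f g z).ShortExact) :
    ∃ (p : cokernel f' ⟶ B) (q : B ⟶ S.X₃) (hpq : p ≫ q = 0),
      (ShortComplex.mk p q hpq).ShortExact := by
  have : Mono f := hS.mono_f
  have : Epi g := hS.epi_g
  have := hT.mono_f
  have := hT.epi_g
  let p := cokernel.desc f' (S.f ≫ g) (by rw [reassoc_of% hf', z])
  let q := hS.exact.desc S.g (by
    change f ≫ S.g = 0
    rw [← hf', Category.assoc, S.zero, comp_zero])
  have hq : g ≫ q = S.g := hS.exact.g_desc _ _
  have hp' : cokernel.π f' ≫ p = S.f ≫ g := cokernel.π_desc _ _ _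
  have hpq : p ≫ q = 0 := by
    rw [← cancel_epi (cokernel.π f'), reassoc_of% hp', hq, S.zero, comp_zero]
  refine ⟨p, q, hpq, ?_⟩
  have : Epi q := epi_of_epi_fac hq
  have : Mono p := by
    refine Preadditive.mono_of_cancel_zero _ fun {W} x hx => ?_
    obtain ⟨W', π, _, y, hy⟩ := surjective_up_to_refinements_of_epi (cokernel.π f') x
    have h₁ : (y ≫ S.f) ≫ g = 0 := by
      rw [Category.assoc, ← hp', ← reassoc_of% hy, hx, comp_zero]
    let a : W' ⟶ A := hS.exact.lift _ h₁
    have ha : a ≫ f = y ≫ S.f := hS.exact.lift_f _ h₁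
    have h₂ : y = a ≫ f' := by
      rw [← cancel_mono S.f, Category.assoc, hf', ha]
    rw [← cancel_epi π, hy, h₂, Category.assoc, cokernel.condition, comp_zero, comp_zero]
  refine ShortComplex.ShortExact.mk' ?_ ‹_› ‹_›
  rw [ShortComplex.exact_iff_exact_up_to_refinements]
  intro W b hb
  dsimp at b hb ⊢
  obtain ⟨W', π, hπ, x, hx⟩ := surjective_up_to_refinements_of_epi g b
  have h₁ : x ≫ S.g = 0 := by rw [← hq, ← reassoc_of% hx, hb, comp_zero]
  refine ⟨W', π, hπ, hT.exact.lift x h₁ ≫ cokernel.π f', ?_⟩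
  rw [Category.assoc, hp', hT.exact.lift_f_assoc, hx]

/-- A filtration with simple quotients induces filtrations on a subobject and on the quotient. -/
theorem HasFiltration.exists_perm_of_shortExact {X : C} {l : List C} (h : HasFiltration X l)
    (hl : ∀ T ∈ l, Simple T) {A B : C} (f : A ⟶ X) (g : X ⟶ B) (z : f ≫ g = 0)
    (hS : (ShortComplex.mk f g z).ShortExact) :
    ∃ lA lB : List C, HasFiltration A lA ∧ HasFiltration B lB ∧ (lA ++ lB).Perm l := by
  induction h generalizing A B with
  | zero X hX =>
    have := hS.mono_f
    have := hS.epi_g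
    exact ⟨[], [], .zero _ (hX.of_mono f), .zero _ (hX.of_epi g), by simp⟩
  | step S hT l h ih =>
    have : Mono f := hS.mono_f
    have : Epi g := hS.epi_g
    have := hT.mono_f
    have := hT.epi_g
    have : Simple S.X₃ := hl _ (by simp)
    have hl' : ∀ T ∈ l, Simple T := fun T hT => hl _ (by simp [hT])
    by_cases hφ : f ≫ S.g = 0
    -- Here $A\subseteq X_1$: the top factor goes to $B$, and induction applies to $X_1/A$.
    · let f' := hT.exact.lift f hφ
      have hf' : f' ≫ S.f = f := hT.exact.lift_f _ _
      have : Mono f' := mono_of_mono_fac hf'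
      obtain ⟨lA, lQ, hA, hQ, hp⟩ := ih hl' f' (cokernel.π f') (cokernel.condition f')
        { exact := ShortComplex.exact_cokernel f' }
      obtain ⟨p, q, hpq, hU⟩ := exists_shortExact_cokernel hT f' g (f := f) hf' z hS
      exact ⟨lA, S.X₃ :: lQ, hA, .step _ hU _ hQ, List.perm_middle.trans (hp.cons _)⟩
    -- Here $A$ covers the simple top factor, which goes to $A$; induction applies to $A\cap
    -- X_1\subseteq X_1$, with quotient still $B$.
    · have : Epi (f ≫ S.g) := epi_of_nonzero_to_simple hφ
      let κ := kernel.ι (f ≫ S.g)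
      have hκ : (κ ≫ f) ≫ S.g = 0 := by rw [Category.assoc]; exact kernel.condition _
      let a := hT.exact.lift (κ ≫ f) hκ
      have ha : a ≫ S.f = κ ≫ f := hT.exact.lift_f _ _
      have hab : a ≫ S.f ≫ g = 0 := by rw [reassoc_of% ha, z, comp_zero]
      have hU : (ShortComplex.mk a (S.f ≫ g) hab).ShortExact := by
        have : Mono (a ≫ S.f) := by rw [ha]; infer_instance
        have : Mono a := mono_of_mono a S.f
        have : Epi (S.f ≫ g) := by
          rw [epi_iff_surjective_up_to_refinements]
          intro W b
          obtain ⟨W₁, π₁, _, x, hx⟩ := surjective_up_to_refinements_of_epi g b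
          obtain ⟨W₂, π₂, _, y, hy⟩ := surjective_up_to_refinements_of_epi (f ≫ S.g) (x ≫ S.g)
          have h₁ : (π₂ ≫ x - y ≫ f) ≫ S.g = 0 := by
            rw [Preadditive.sub_comp, Category.assoc, Category.assoc, hy, sub_self]
          refine ⟨W₂, π₂ ≫ π₁, inferInstance, hT.exact.lift _ h₁, ?_⟩
          rw [hT.exact.lift_f_assoc, Preadditive.sub_comp, Category.assoc, Category.assoc,
            Category.assoc, z, comp_zero, sub_zero, hx]
        refine ShortComplex.ShortExact.mk' ?_ ‹_› ‹_›
        refine ShortComplex.exact_of_f_is_kernel _ (KernelFork.IsLimit.ofι' _ _ fun {W} k hk => ?_)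
        have h₁ : (k ≫ S.f) ≫ g = 0 := by simpa using hk
        let m : W ⟶ A := hS.exact.lift _ h₁
        have hm : m ≫ f = k ≫ S.f := hS.exact.lift_f _ h₁
        have h₂ : m ≫ f ≫ S.g = 0 := by rw [reassoc_of% hm, S.zero, comp_zero]
        refine ⟨kernel.lift _ m h₂, ?_⟩
        dsimp
        rw [← cancel_mono S.f, Category.assoc, ha, kernel.lift_ι_assoc, hm]
      obtain ⟨lA, lB, hA, hB, hp⟩ := ih hl' a (S.f ≫ g) hab hU
      exact ⟨S.X₃ :: lA, lB, .step (ShortComplex.mk κ (f ≫ S.g) (kernel.condition _))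
        { exact := ShortComplex.exact_kernel _ } _ hA, hB, hp.cons _⟩

theorem HasFiltration.prop_of_mem {X : C} {l : List C} (h : HasFiltration X l)
    (P : ObjectProperty C) [P.IsSerreClass] (hX : P X) : ∀ T ∈ l, P T := by
  induction h with
  | zero => simp
  | step S hS l h ih =>
    intro T hT
    rcases List.mem_cons.1 hT with rfl | hT
    · exact P.prop_X₃_of_shortExact hS hX
    · exact ih (P.prop_X₁_of_shortExact hS hX) T hT

theorem HasFiltration.prop_of_forall_mem {X : C} {l : List C} (h : HasFiltration X l)
    (P : ObjectProperty C) [P.IsSerreClass] (hl : ∀ T ∈ l, P T) : P X := by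
  induction h with
  | zero X hX => exact P.prop_of_isZero hX
  | step S hS l h ih =>
    exact P.prop_X₂_of_shortExact hS (ih fun T hT => hl T (by simp [hT])) (hl _ (by simp))

theorem HasFiltration.exists_iso_of_simple {X : C} {l : List C} (h : HasFiltration X l)
    (hl : ∀ T ∈ l, Simple T) [Simple X] : ∃ T ∈ l, Nonempty (T ≅ X) := by
  cases h with
  | zero _ hX => exact (Simple.not_isZero X hX).elim
  | step S hS l h =>
    have := hS.epi_g
    have : Simple S.X₃ := hl _ (by simp)
    have : IsIso S.g := isIso_of_epi_of_nonzero fun h0 =>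
      Simple.not_isZero S.X₃ (IsZero.of_epi_eq_zero _ h0)
    exact ⟨_, by simp, ⟨(asIso S.g).symm⟩⟩

theorem isIso_of_simple_of_ne_zero {X Y : C} [Simple X] [Simple Y] (f : X ⟶ Y) (hf : f ≠ 0) :
    IsIso f := by
  have : Epi f := epi_of_nonzero_to_simple hf
  exact isIso_of_epi_of_nonzero hf

end CompositionSeries

/-! ### Serre subcategories generated by simple objects -/

section SerreSub

open ZeroObject
variable {C : Type u} [Category.{v} C] [Abelian C] {Λ : Type w} {L : Λ → C}

theorem serreSub_mono {Ω Ω' : Set Λ} (h : Ω ⊆ Ω') : serreSub L Ω ≤ serreSub L Ω' :=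
  fun _ hX P hP hL => hX P hP fun a ha => hL a (h ha)

theorem serreSub_of_mem {Ω : Set Λ} {a : Λ} (ha : a ∈ Ω) : serreSub L Ω (L a) :=
  fun _ _ h => h a ha

/-- Objects filtered by the given simples form a Serre class, because composition factors distribute
over subobjects and quotients. -/
theorem LabelsSimples.serreSub_iff (hL : LabelsSimples L) (Ω : Set Λ) (X : C) :
    serreSub L Ω X ↔ ∃ l, HasFiltration X l ∧ ∀ T ∈ l, ∃ a ∈ Ω, Nonempty (T ≅ L a) := by
  constructor
  · intro hX
    refine hX (fun X => ∃ l, HasFiltration X l ∧ ∀ T ∈ l, ∃ a ∈ Ω, Nonempty (T ≅ L a)) ?_ ?_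
    · have key : ∀ {S : ShortComplex C}, S.ShortExact →
          (∃ l, HasFiltration S.X₂ l ∧ ∀ T ∈ l, ∃ a ∈ Ω, Nonempty (T ≅ L a)) →
          (∃ l, HasFiltration S.X₁ l ∧ ∀ T ∈ l, ∃ a ∈ Ω, Nonempty (T ≅ L a)) ∧
          (∃ l, HasFiltration S.X₃ l ∧ ∀ T ∈ l, ∃ a ∈ Ω, Nonempty (T ≅ L a)) := by
        rintro S hS ⟨l, h, hl⟩
        have hs : ∀ T ∈ l, Simple T := fun T hT => by
          obtain ⟨a, -, ⟨e⟩⟩ := hl T hT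
          have := hL.simple a
          exact Simple.of_iso e
        obtain ⟨lA, lB, hA, hB, hp⟩ := h.exists_perm_of_shortExact hs S.f S.g S.zero hS
        exact ⟨⟨lA, hA, fun T hT => hl T (hp.mem_iff.1 (by simp [hT]))⟩,
          ⟨lB, hB, fun T hT => hl T (hp.mem_iff.1 (by simp [hT]))⟩⟩
      exact
        { exists_zero := ⟨0, isZero_zero C, [], .zero _ (isZero_zero C), by simp⟩
          prop_of_mono := fun f _ h => (key (S := ShortComplex.mk _ _ (cokernel.condition f))
            { exact := ShortComplex.exact_cokernel f } h).1
          prop_of_epi := fun f _ h => (key (S := ShortComplex.mk _ _ (kernel.condition f))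
            { exact := ShortComplex.exact_kernel f } h).2
          prop_X₂_of_shortExact := fun {S} hS ⟨l₁, h₁, hl₁⟩ ⟨l₃, h₃, hl₃⟩ =>
            ⟨_, h₁.append _ _ _ hS h₃, fun T hT =>
              (List.mem_append.1 hT).elim (hl₃ T) (hl₁ T)⟩ }
    · intro a ha
      refine ⟨[L a], .step (ShortComplex.mk (0 : (0 : C) ⟶ L a) (𝟙 _) (by simp)) ?_ []
        (.zero _ (isZero_zero C)), by simpa using ⟨a, ha, ⟨Iso.refl _⟩⟩⟩
      refine ShortComplex.ShortExact.mk' ?_ (by dsimp; infer_instance) (by dsimp; infer_instance)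
      exact (ShortComplex.exact_iff_mono _ rfl).2 (by dsimp; infer_instance)
  · rintro ⟨l, h, hl⟩
    refine h.prop_of_forall_mem _ fun T hT => ?_
    obtain ⟨a, ha, ⟨e⟩⟩ := hl T hT
    exact (serreSub L Ω).prop_of_iso e.symm (serreSub_of_mem ha)

theorem LabelsSimples.exists_iso_of_serreSub (hL : LabelsSimples L) {Ω : Set Λ} {T : C} [Simple T]
    (h : serreSub L Ω T) : ∃ a ∈ Ω, Nonempty (T ≅ L a) := by
  obtain ⟨l, h, hl⟩ := (hL.serreSub_iff Ω T).1 h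
  obtain ⟨T', hT', ⟨e⟩⟩ := h.exists_iso_of_simple fun T hT => by
    obtain ⟨a, -, ⟨e⟩⟩ := hl T hT
    have := hL.simple a
    exact Simple.of_iso e
  obtain ⟨a, ha, ⟨e'⟩⟩ := hl T' hT'
  exact ⟨a, ha, ⟨e.symm ≪≫ e'⟩⟩

theorem LabelsSimples.mem_of_serreSub (hL : LabelsSimples L) {Ω : Set Λ} {a : Λ}
    (h : serreSub L Ω (L a)) : a ∈ Ω := by
  have := hL.simple a
  obtain ⟨b, hb, e⟩ := hL.exists_iso_of_serreSub h
  rwa [hL.eq_of_iso a b e]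

/-- The subobject $L(a)$ uses up the only composition factor $L(a)$ of $X$. -/
theorem LabelsSimples.serreSub_cokernel [PartialOrder Λ] (hL : LabelsSimples L) {a : Λ} {X : C}
    (hX : serreSub L (Set.Iic a) X) (hm : HasMultiplicity X (L a) 1) (i : L a ⟶ X) [Mono i] :
    serreSub L (Set.Iio a) (cokernel i) := by
  classical
  obtain ⟨l, ⟨hl, hs⟩, hc⟩ := hm
  have := hL.simple a
  obtain ⟨lA, lB, hA, hB, hp⟩ := hl.exists_perm_of_shortExact hs i (cokernel.π i)
    (cokernel.condition i) { exact := ShortComplex.exact_cokernel i }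
  have hsA : ∀ T ∈ lA, Simple T := fun T hT => hs T (hp.mem_iff.1 (by simp [hT]))
  have hsB : ∀ T ∈ lB, Simple T := fun T hT => hs T (hp.mem_iff.1 (by simp [hT]))
  obtain ⟨T, hT, hTa⟩ := hA.exists_iso_of_simple hsA
  have h₁ : 0 < lA.countP (fun Y => Nonempty (Y ≅ L a)) :=
    List.countP_pos_iff.2 ⟨T, hT, by simpa using hTa⟩
  have h₂ := hp.countP_eq (fun Y => Nonempty (Y ≅ L a))
  rw [List.countP_append] at h₂
  have h₃ : lB.countP (fun Y => Nonempty (Y ≅ L a)) = 0 := by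
    have : l.countP (fun Y => Nonempty (Y ≅ L a)) = 1 := by convert hc
    omega
  rw [List.countP_eq_zero] at h₃
  have hcok : serreSub L (Set.Iic a) (cokernel i) := (serreSub L _).prop_of_epi (cokernel.π i) hX
  refine (hL.serreSub_iff _ _).2 ⟨lB, hB, fun T hT => ?_⟩
  have := hsB T hT
  obtain ⟨b, hb, e⟩ := hL.exists_iso_of_serreSub (hB.prop_of_mem _ hcok T hT)
  refine ⟨b, lt_of_le_of_ne hb ?_, e⟩
  rintro rfl
  exact h₃ T hT (by simpa using e)

end SerreSub

section FiniteLowerSets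

variable {C : Type u} [Category.{v} C] [Abelian C] {Λ : Type t} [PartialOrder Λ] {L : Λ → C}

theorem exists_finite_isLowerSet_serreSub (hL : LabelsSimples L)
    (hlow : ∀ a : Λ, (Set.Iic a).Finite) {X : C} (hX : ∃ l, HasCompositionSeries X l) :
    ∃ Ω : Set Λ, Ω.Finite ∧ IsLowerSet Ω ∧ serreSub L Ω X := by
  obtain ⟨l, hl, hs⟩ := hX
  induction hl with
  | zero X hX =>
    exact ⟨∅, Set.finite_empty, isLowerSet_empty, (serreSub L _).prop_of_isZero hX⟩
  | step S hS l _ ih =>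
    obtain ⟨Ω, h₁, h₂, h₃⟩ := ih fun T hT => hs T (by simp [hT])
    obtain ⟨a, ⟨e⟩⟩ := hL.exists_iso S.X₃ (hs _ (by simp))
    refine ⟨Ω ∪ Set.Iic a, h₁.union (hlow a), h₂.union (isLowerSet_Iic a),
      (serreSub L _).prop_X₂_of_shortExact hS (serreSub_mono Set.subset_union_left _ h₃)
        ((serreSub L _).prop_of_iso e.symm (serreSub_of_mem (Or.inr le_rfl)))⟩

end FiniteLowerSets

/-! ### Objects acyclic up to a finite ideal -/

section StandardData

open Abelian
variable {C : Type u} [Category.{v} C] [Abelian C] [HasExt.{w} C] {Λ : Type t}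

/-- Families of costandard objects `N a` and standard objects `D a` with the vanishing properties
of extension groups which characterise highest weight categories. -/
structure StandardData [PartialOrder Λ] (L N D : Λ → C) : Prop where
  costandard_mem : ∀ a, serreSub L (Set.Iic a) (N a)
  standard_mem : ∀ a, serreSub L (Set.Iic a) (D a)
  exists_mono : ∀ a, ∃ i : L a ⟶ N a, Mono i ∧ serreSub L (Set.Iio a) (cokernel i)
  exists_epi : ∀ a, ∃ p : D a ⟶ L a, Epi p
  ext_simple : ∀ a b, ¬ a < b → ∀ e : Ext.{w} (L b) (N a) 1, e = 0
  ext_one : ∀ a b, ∀ e : Ext.{w} (D b) (N a) 1, e = 0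
  ext_two : ∀ a b, ∀ e : Ext.{w} (D b) (N a) 2, e = 0

/-- An object `I` is acyclic up to `Ω` if it has no first extensions by the simple objects with
labels in `Ω`, and no first and second extensions by all standard objects. -/
structure IsAcyclicUpTo (L D : Λ → C) (Ω : Set Λ) (I : C) : Prop where
  ext_simple : ∀ a ∈ Ω, ∀ e : Ext.{w} (L a) I 1, e = 0
  ext_one : ∀ a, ∀ e : Ext.{w} (D a) I 1, e = 0
  ext_two : ∀ a, ∀ e : Ext.{w} (D a) I 2, e = 0

variable {L N D : Λ → C}

theorem ext_eq_zero_of_serreSub (hL : LabelsSimples L) {Ω : Set Λ} {I : C} {n : ℕ}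
    (h : ∀ a ∈ Ω, ∀ e : Ext.{w} (L a) I n, e = 0) {M : C} (hM : serreSub L Ω M)
    (e : Ext.{w} M I n) : e = 0 := by
  obtain ⟨l, hl, hlΩ⟩ := (hL.serreSub_iff Ω M).1 hM
  clear hM
  induction hl with
  | zero X hX =>
    rw [← Ext.mk₀_id_comp e, hX.eq_of_src (𝟙 X) 0, Ext.mk₀_zero, Ext.zero_comp]
  | step S hS l _ ih =>
    refine ext_eq_zero_of_shortExact_left hS (ih · fun T hT => hlΩ T (by simp [hT])) (fun e => ?_) e
    obtain ⟨a, ha, ⟨i⟩⟩ := hlΩ S.X₃ (by simp)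
    have h₁ := h a ha ((Ext.mk₀ i.inv).comp e (zero_add n))
    rw [← Ext.mk₀_id_comp e, ← i.hom_inv_id, ← Ext.mk₀_comp_mk₀,
      Ext.comp_assoc_of_second_deg_zero, h₁, Ext.comp_zero]

theorem IsAcyclicUpTo.of_shortExact {Ω : Set Λ} {S : ShortComplex C} (hS : S.ShortExact)
    (h₁ : IsAcyclicUpTo.{w} L D Ω S.X₁) (h₃ : IsAcyclicUpTo.{w} L D Ω S.X₃) :
    IsAcyclicUpTo.{w} L D Ω S.X₂ where
  ext_simple a ha :=
    ext_eq_zero_of_shortExact_right hS (h₁.ext_simple a ha) (h₃.ext_simple a ha)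
  ext_one a := ext_eq_zero_of_shortExact_right hS (h₁.ext_one a) (h₃.ext_one a)
  ext_two a := ext_eq_zero_of_shortExact_right hS (h₁.ext_two a) (h₃.ext_two a)

theorem IsAcyclicUpTo.ext_one_eq_zero (hL : LabelsSimples L) {Ω : Set Λ} {I M : C}
    (h : IsAcyclicUpTo.{w} L D Ω I) (hM : serreSub L Ω M) (e : Ext.{w} M I 1) : e = 0 :=
  ext_eq_zero_of_serreSub hL h.ext_simple hM e

variable [PartialOrder Λ]

/-- For $K=\ker(\Delta(a)\to L(a))\in\mathbf{C}_\Omega$, the group $\mathrm{Ext}^2(L(a),I)$ sits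
between $\mathrm{Ext}^1(K,I)=0$ and $\mathrm{Ext}^2(\Delta(a),I)=0$. -/
theorem IsAcyclicUpTo.ext_two_eq_zero (hL : LabelsSimples L) (hd : StandardData.{w} L N D)
    {Ω : Set Λ} (hΩ : IsLowerSet Ω) {I M : C} (h : IsAcyclicUpTo.{w} L D Ω I)
    (hM : serreSub L Ω M) (e : Ext.{w} M I 2) : e = 0 := by
  refine ext_eq_zero_of_serreSub hL (fun a ha e => ?_) hM e
  obtain ⟨p, hp⟩ := hd.exists_epi a
  have hS : (ShortComplex.mk _ _ (kernel.condition p)).ShortExact :=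
    { exact := ShortComplex.exact_kernel p }
  obtain ⟨x, rfl⟩ := Ext.contravariant_sequence_exact₃ hS I e (h.ext_two a _) (n₀ := 1) rfl
  have hK : serreSub L Ω (kernel p) := (serreSub L Ω).prop_of_mono (kernel.ι p)
    (serreSub_mono (fun b hb => hΩ hb ha) _ (hd.standard_mem a))
  rw [h.ext_one_eq_zero hL hK x, Ext.comp_zero]

theorem StandardData.isAcyclicUpTo (hd : StandardData.{w} L N D) {Ω : Set Λ} {a : Λ}
    (h : ∀ b ∈ Ω, ¬ a < b) : IsAcyclicUpTo.{w} L D Ω (N a) where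
  ext_simple b hb := hd.ext_simple a b (h b hb)
  ext_one := hd.ext_one a
  ext_two := hd.ext_two a

variable (k : Type*) [Field k] [Linear k C]

/-- As $\mathrm{Ext}^1(\Delta(a),I)=0$, the group is a quotient of $\mathrm{Hom}(\ker(\Delta(a)\to
L(a)),I)$. -/
theorem IsAcyclicUpTo.finite_ext (hfin : ∀ X Y : C, Module.Finite k (X ⟶ Y))
    (hd : StandardData.{w} L N D) {Ω : Set Λ} {I : C} (h : IsAcyclicUpTo.{w} L D Ω I) (a : Λ) :
    Module.Finite k (Ext.{w} (L a) I 1) := by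
  obtain ⟨p, hp⟩ := hd.exists_epi a
  have hS : (ShortComplex.mk _ _ (kernel.condition p)).ShortExact :=
    { exact := ShortComplex.exact_kernel p }
  have : Module.Finite k (Ext.{w} (kernel p) I 0) :=
    have := hfin (kernel p) I
    Module.Finite.equiv (Ext.linearEquiv₀ (R := k) (X := kernel p) (Y := I)).symm
  refine Module.Finite.of_surjective
    (Ext.precompOfLinear hS.extClass k I (add_zero 1)) fun e => ?_
  exact Ext.contravariant_sequence_exact₃ hS I e (h.ext_one a _) (add_zero 1)

/-- Repeated extension by $\nabla(a)$ lowers $\dim\mathrm{Ext}^1(L(a),I)$ until it is zero. The last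
two clauses record what is needed of $J/I$ being filtered by $\nabla(a)$: membership in Serre
classes, and injectivity of $\mathrm{Ext}^{n+1}(M,I)\to\mathrm{Ext}^{n+1}(M,J)$. -/
theorem IsAcyclicUpTo.exists_insert (hfin : ∀ X Y : C, Module.Finite k (X ⟶ Y))
    (hL : LabelsSimples L) (hd : StandardData.{w} L N D) {Ω : Set Λ} (hΩ : IsLowerSet Ω) {a : Λ}
    (ha : a ∉ Ω) (haΩ : Set.Iio a ⊆ Ω) {I : C} (h : IsAcyclicUpTo.{w} L D Ω I) :
    ∃ (J : C) (f : I ⟶ J), Mono f ∧ IsAcyclicUpTo.{w} L D (insert a Ω) J ∧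
      (∀ P : ObjectProperty C, P.IsSerreClass → P I → P (N a) → P J) ∧
      ∀ (M : C) (n : ℕ), (∀ e : Ext.{w} M (N a) n, e = 0) →
        ∀ e : Ext.{w} M I (n + 1), e.comp (Ext.mk₀ f) (add_zero _) = 0 → e = 0 := by
  induction hr : Module.finrank k (Ext.{w} (L a) I 1) using Nat.strong_induction_on
    generalizing I with
  | _ r ih =>
    by_cases h0 : ∀ e : Ext.{w} (L a) I 1, e = 0
    · refine ⟨I, 𝟙 I, inferInstance, ⟨?_, h.ext_one, h.ext_two⟩, fun P _ h _ => h,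
        fun M n _ e he => by rwa [Ext.comp_mk₀_id] at he⟩
      rintro b (rfl | hb)
      exacts [h0, h.ext_simple b hb]
    · push Not at h0
      obtain ⟨e₀, he₀⟩ := h0
      obtain ⟨i, hi, hQ⟩ := hd.exists_mono a
      have hS : (ShortComplex.mk _ _ (cokernel.condition i)).ShortExact :=
        { exact := ShortComplex.exact_cokernel i }
      -- The obstruction to extending $e_0$ from $L(a)$ to $\nabla(a)$ lies in
      -- $\mathrm{Ext}^2(\nabla(a)/L(a),I)$, which vanishes since all weights below $a$ are in
      -- $\Omega$.
      obtain ⟨e₁, he₁⟩ := Ext.contravariant_sequence_exact₁ hS I e₀ (n₁ := 2) rfl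
        (h.ext_two_eq_zero hL hd hΩ (serreSub_mono haΩ _ hQ) _)
      obtain ⟨E, f, g, z, hE, rfl⟩ := exists_shortExact_extClass_eq e₁
      have hN : IsAcyclicUpTo.{w} L D Ω (N a) := hd.isAcyclicUpTo fun b hb hab =>
        ha (hΩ hab.le hb)
      have hEΩ : IsAcyclicUpTo.{w} L D Ω E := .of_shortExact hE h hN
      have := h.finite_ext k hfin hd a
      let φ : Ext.{w} (L a) I 1 →ₗ[k] Ext.{w} (L a) E 1 :=
        Ext.postcompOfLinear (Ext.mk₀ f) k (L a) (add_zero 1)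
      -- Surjective because $\mathrm{Ext}^1(L(a),\nabla(a))=0$; not injective because $e_0$ dies in
      -- $E$. So the dimension drops.
      have hφ : LinearMap.range φ = ⊤ := by
        rw [LinearMap.range_eq_top]
        exact fun e => Ext.covariant_sequence_exact₂ (L a) hE e
          (hd.ext_simple a a (lt_irrefl a) _)
      have hker : e₀ ∈ LinearMap.ker φ := by
        change e₀.comp (Ext.mk₀ f) (add_zero 1) = 0
        have h₁ := hE.extClass_comp
        dsimp at h₁ he₁
        rw [← he₁, Ext.comp_assoc_of_third_deg_zero, h₁, Ext.comp_zero]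
      have hpos : 0 < Module.finrank k (LinearMap.ker φ) := by
        have : Nontrivial (LinearMap.ker φ) :=
          ⟨⟨e₀, hker⟩, 0, fun h => he₀ (congrArg Subtype.val h)⟩
        exact Module.finrank_pos
      have hrank := φ.finrank_range_add_finrank_ker
      rw [hφ, finrank_top] at hrank
      obtain ⟨J, f', hf', hJ, hP, hinj⟩ := ih _ (by omega) hEΩ rfl
      have : Mono f := hE.mono_f
      refine ⟨J, f ≫ f', inferInstance, hJ, fun P hP' h₁ h₂ =>
        hP P hP' (P.prop_X₂_of_shortExact hE h₁ h₂) h₂, fun M n hM e he => ?_⟩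
      rw [← Ext.mk₀_comp_mk₀, ← Ext.comp_assoc_of_second_deg_zero] at he
      obtain ⟨x, rfl⟩ := Ext.covariant_sequence_exact₁ M hE e (hinj M n hM _ he) rfl
      rw [hM x, Ext.zero_comp]

theorem IsAcyclicUpTo.exists_of_subset (hfin : ∀ X Y : C, Module.Finite k (X ⟶ Y))
    (hL : LabelsSimples L) (hd : StandardData.{w} L N D) {Ω Ω' : Set Λ} (hΩ : IsLowerSet Ω)
    (hΩ' : IsLowerSet Ω') (hfin' : Ω'.Finite) (hsub : Ω ⊆ Ω') {I : C}
    (h : IsAcyclicUpTo.{w} L D Ω I) :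
    ∃ (J : C) (f : I ⟶ J), Mono f ∧ IsAcyclicUpTo.{w} L D Ω' J ∧
      (∀ P : ObjectProperty C, P.IsSerreClass → P I → (∀ a ∈ Ω', P (N a)) → P J) ∧
      ∀ (M : C) (n : ℕ), (∀ a ∉ Ω, ∀ e : Ext.{w} M (N a) n, e = 0) →
        ∀ e : Ext.{w} M I (n + 1), e.comp (Ext.mk₀ f) (add_zero _) = 0 → e = 0 := by
  induction hr : (Ω' \ Ω).ncard generalizing Ω I with
  | zero =>
    have : Ω = Ω' := by
      rw [Set.ncard_eq_zero hfin'.sdiff, Set.sdiff_eq_empty] at hr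
      exact hsub.antisymm hr
    subst this
    exact ⟨I, 𝟙 I, inferInstance, h, fun P _ h _ => h,
      fun M n _ e he => by rwa [Ext.comp_mk₀_id] at he⟩
  | succ r ih =>
    -- Weights are added in an order compatible with $\le$, so each intermediate set is an ideal.
    obtain ⟨a, ha⟩ := (hfin'.sdiff (t := Ω)).exists_minimal
      (Set.nonempty_of_ncard_ne_zero (by omega))
    have haΩ : Set.Iio a ⊆ Ω := fun b hb => by
      by_contra hbΩ
      exact (ha.not_lt ⟨hΩ' (le_of_lt hb) ha.prop.1, hbΩ⟩) hb
    obtain ⟨J, f, hf, hJ, hP, hinj⟩ := h.exists_insert k hfin hL hd hΩ ha.prop.2 haΩ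
    have hΩa : IsLowerSet (insert a Ω) := by
      rintro b c hcb (rfl | hb)
      · rcases hcb.eq_or_lt with rfl | hlt
        exacts [Or.inl rfl, Or.inr (haΩ hlt)]
      · exact Or.inr (hΩ hcb hb)
    have hcard : (Ω' \ insert a Ω).ncard = r := by
      have h₁ : Ω' \ insert a Ω = (Ω' \ Ω) \ {a} := by
        ext b; simp only [Set.mem_sdiff, Set.mem_insert_iff, Set.mem_singleton_iff]; tauto
      rw [h₁, Set.ncard_sdiff_singleton_of_mem ha.prop, hr, Nat.add_sub_cancel]
    obtain ⟨J', f', hf', hJ', hP', hinj'⟩ :=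
      ih hΩa (Set.insert_subset ha.prop.1 hsub) hJ hcard
    refine ⟨J', f ≫ f', inferInstance, hJ', fun P hPS h₁ h₂ =>
      hP' P hPS (hP P hPS h₁ (h₂ a ha.prop.1)) h₂, fun M n hM e he => ?_⟩
    rw [← Ext.mk₀_comp_mk₀, ← Ext.comp_assoc_of_second_deg_zero] at he
    exact hinj M n (hM a ha.prop.2) e
      (hinj' M n (fun b hb => hM b fun hb' => hb (Or.inr hb')) _ he)

theorem IsAcyclicUpTo.ext_eq_zero (hfin : ∀ X Y : C, Module.Finite k (X ⟶ Y))
    (hfl : ∀ X : C, ∃ l, HasCompositionSeries X l)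
    (hL : LabelsSimples L) (hlow : ∀ a : Λ, (Set.Iic a).Finite) (hd : StandardData.{w} L N D)
    (n : ℕ) : ∀ {Ω : Set Λ}, IsLowerSet Ω → Ω.Finite → ∀ {I M : C}, IsAcyclicUpTo.{w} L D Ω I →
      serreSub L Ω M → ∀ e : Ext.{w} M I (n + 1), e = 0 := by
  induction n with
  | zero => exact fun _ _ I M h hM e => h.ext_one_eq_zero hL hM e
  | succ n ih =>
    intro Ω hΩ hΩfin I M h hM e
    obtain ⟨Z, u, hu, hue⟩ := exists_mono_comp_mk₀_eq_zero e
    obtain ⟨Ω₁, h₁, h₂, h₃⟩ := exists_finite_isLowerSet_serreSub hL hlow (hfl Z)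
    obtain ⟨J, f, hf, hJ, -, hinj⟩ := h.exists_of_subset k hfin hL hd hΩ (hΩ.union h₂)
      (hΩfin.union h₁) Set.subset_union_left
    have hS : (ShortComplex.mk _ _ (cokernel.condition u)).ShortExact :=
      { exact := ShortComplex.exact_cokernel u }
    -- The inclusion $I\to J$ extends to $Z$ because $\mathrm{Ext}^1(Z/I,J)=0$; hence $e$, which
    -- dies in $Z$, dies in $J$.
    obtain ⟨g, hg⟩ := exists_extension_of_ext_one hS
      (hJ.ext_one_eq_zero hL ((serreSub L _).prop_of_epi (cokernel.π u)
        (serreSub_mono Set.subset_union_right _ h₃))) f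
    dsimp at g hg
    refine hinj M (n + 1) (fun a ha => ?_) e ?_
    -- For $a\notin\Omega$ no weight of $\Omega\cup{\le}a$ exceeds $a$, so $\nabla(a)$ is acyclic up
    -- to this larger ideal and the induction hypothesis applies to it.
    · refine ih (hΩ.union (isLowerSet_Iic a)) (hΩfin.union (hlow a)) (hd.isAcyclicUpTo ?_)
        (serreSub_mono Set.subset_union_left _ hM)
      rintro b (hb | hb) hab
      · exact ha (hΩ hab.le hb)
      · exact hab.not_ge hb
    · rw [← hg, ← Ext.mk₀_comp_mk₀, ← Ext.comp_assoc_of_second_deg_zero, hue, Ext.zero_comp]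

theorem IsAcyclicUpTo.exists_mono (hfin : ∀ X Y : C, Module.Finite k (X ⟶ Y))
    (hL : LabelsSimples L) (hd : StandardData.{w} L N D)
    {Ω : Set Λ} (hΩ : IsLowerSet Ω) (hΩfin : Ω.Finite) {X : C} (hX : serreSub L Ω X) :
    ∃ (J : C) (i : X ⟶ J), Mono i ∧ serreSub L Ω J ∧ IsAcyclicUpTo.{w} L D Ω J := by
  obtain ⟨l, hl, hlΩ⟩ := (hL.serreSub_iff Ω X).1 hX
  clear hX
  induction hl with
  | zero X hX =>
    have h0 : ∀ (M : C) (n : ℕ) (e : Ext.{w} M X n), e = 0 := fun M n e => by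
      rw [← Ext.comp_mk₀_id e, hX.eq_of_src (𝟙 X) 0, Ext.mk₀_zero, Ext.comp_zero]
    exact ⟨X, 𝟙 X, inferInstance, (serreSub L Ω).prop_of_isZero hX,
      fun _ _ => h0 _ _, fun _ => h0 _ _, fun _ => h0 _ _⟩
  | step S hS l _ ih =>
    obtain ⟨J₁, i₁, _, hJ₁, hA₁⟩ := ih fun T hT => hlΩ T (by simp [hT])
    obtain ⟨a, ha, ⟨e⟩⟩ := hlΩ S.X₃ (by simp)
    obtain ⟨i, _, -⟩ := hd.exists_mono a
    obtain ⟨J₃, i₃, _, hA₃, hP₃, -⟩ := (hd.isAcyclicUpTo (a := a) (Ω := Set.Iic a)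
      fun b hb hab => hab.not_ge hb).exists_of_subset k hfin hL hd (isLowerSet_Iic a) hΩ hΩfin
        (fun b hb => hΩ hb ha)
    have hN : ∀ b ∈ Ω, serreSub L Ω (N b) := fun b hb =>
      serreSub_mono (fun c hc => hΩ hc hb) _ (hd.costandard_mem b)
    have hJ₃ := hP₃ (serreSub L Ω) inferInstance (hN a ha) hN
    obtain ⟨g, hg⟩ := exists_extension_of_ext_one hS (hA₁.ext_one_eq_zero hL
      ((serreSub L Ω).prop_of_iso e.symm (serreSub_of_mem ha))) i₁
    have hB := (ShortComplex.Splitting.ofHasBinaryBiproduct J₁ J₃).shortExact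
    -- The first component extends the embedding of $X_1$; the second embeds the simple quotient via
    -- $L(a)\hookrightarrow\nabla(a)\hookrightarrow J_3$.
    refine ⟨J₁ ⊞ J₃, biprod.lift g (S.g ≫ e.hom ≫ i ≫ i₃), ?_,
      (serreSub L Ω).prop_X₂_of_shortExact hB hJ₁ hJ₃, .of_shortExact hB hA₁ hA₃⟩
    refine Preadditive.mono_of_cancel_zero _ fun {W} x hx => ?_
    have hx₁ := congrArg (· ≫ biprod.fst) hx
    have hx₂ := congrArg (· ≫ biprod.snd) hx
    rw [Category.assoc, biprod.lift_fst, zero_comp] at hx₁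
    rw [Category.assoc, biprod.lift_snd, zero_comp, ← Category.assoc] at hx₂
    have hx₃ := zero_of_comp_mono (e.hom ≫ i ≫ i₃) hx₂
    have := hS.mono_f
    have hy := hS.exact.lift_f x hx₃
    rw [← hy, Category.assoc, hg] at hx₁
    rw [← hy, zero_of_comp_mono i₁ hx₁, zero_comp]

end StandardData

section StandardDataExtensionFull

variable {C : Type u} [Category.{v} C] [Abelian C] {Λ : Type t} [PartialOrder Λ]

theorem StandardData.extensionFull (k : Type*) [Field k] [Linear k C]
    (hC : IsFiniteLengthCategory k C) {L N D : Λ → C}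
    (hL : LabelsSimples L) (hlow : ∀ a : Λ, (Set.Iic a).Finite)
    (hd : letI := HasExt.standard C; StandardData L N D)
    {Ω : Set Λ} (hΩ : IsLowerSet Ω) (hΩfin : Ω.Finite) : ExtensionFull (serreSub L Ω) := by
  refine extensionFull_of_enough_acyclic _ fun X hX => ?_
  let := HasExt.standard C
  obtain ⟨J, i, hi, hJ, hA⟩ := IsAcyclicUpTo.exists_mono k hC.finite_hom hL hd hΩ hΩfin hX
  exact ⟨J, i, hi, hJ, fun M hM n e => IsAcyclicUpTo.ext_eq_zero k hC.finite_hom hC.finite_length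
    hL hlow hd n hΩ hΩfin hA hM e⟩

end StandardDataExtensionFull

/-! ### Vanishing from relative injectives and projectives; version $\dagger$ -/

section FullSubcategory

open Abelian
variable {C : Type u} [Category.{v} C] [Abelian C] [HasExt.{w} C]
  (P : ObjectProperty C) [P.IsSerreClass]

theorem ext_one_eq_zero_of_isInjectiveIn {M I : C} (hI : IsInjectiveIn P I) (hM : P M)
    (e : Ext.{w} M I 1) : e = 0 := by
  obtain ⟨hPI, hI⟩ := hI
  refine ext_one_eq_zero_of_retraction (fun E f g z h => ?_) e
  have hE : P E := P.prop_X₂_of_shortExact h hPI hM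
  have := h.mono_f
  let f' : (⟨I, hPI⟩ : P.FullSubcategory) ⟶ ⟨E, hE⟩ := P.homMk f
  have : Mono f' := P.ι.mono_of_mono_map (inferInstanceAs (Mono f))
  exact ⟨(Injective.factorThru (𝟙 _) f').hom,
    congrArg (·.hom) (Injective.comp_factorThru (𝟙 _) f')⟩

theorem ext_one_eq_zero_of_projective {Q N : C} (hQ : P Q)
    (hproj : Projective (⟨Q, hQ⟩ : P.FullSubcategory)) (hN : P N) (e : Ext.{w} Q N 1) : e = 0 := by
  refine ext_one_eq_zero_of_section (fun E f g z h => ?_) e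
  have hE : P E := P.prop_X₂_of_shortExact h hN hQ
  have := h.epi_g
  let g' : (⟨E, hE⟩ : P.FullSubcategory) ⟶ ⟨Q, hQ⟩ := P.homMk g
  have : Epi g' := P.ι.epi_of_epi_map (inferInstanceAs (Epi g))
  exact ⟨(Projective.factorThru (𝟙 _) g').hom,
    congrArg (·.hom) (Projective.factorThru_comp (𝟙 _) g')⟩

end FullSubcategory

section Dagger

open Abelian
variable {C : Type u} [Category.{v} C] [Abelian C] {Λ : Type t} [PartialOrder Λ] {L N D : Λ → C}

theorem IsLFHWDaggerWith.standardData (hL : LabelsSimples L)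
    (hlow : ∀ a : Λ, (Set.Iic a).Finite) (h : IsLFHWDaggerWith L N D) :
    letI := HasExt.standard C; StandardData L N D := by
  let := HasExt.standard C
  have hinj : ∀ a b, ¬ a < b → ∀ M, serreSub L (Set.Iic b) M → ∀ e : Ext M (N a) 1, e = 0 := by
    intro a b hab M hM e
    -- Unless $a<b$, the weight $a$ is maximal in the finite ideal ${\le}a\cup{\le}b$.
    refine ext_one_eq_zero_of_isInjectiveIn _ (h.injective a (Set.Iic a ∪ Set.Iic b)
      ((hlow a).union (hlow b)) ((isLowerSet_Iic a).union (isLowerSet_Iic b))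
      ⟨Or.inl le_rfl, ?_⟩) (serreSub_mono Set.subset_union_right _ hM) e
    rintro c (hc | hc) hac
    · exact hc
    · rcases (hac.trans hc).eq_or_lt with rfl | hlt
      exacts [hc, (hab hlt).elim]
  constructor
  · exact fun a => (h.injectiveHull a).2.1
  · exact fun a => (h.projectiveCover a).2.1
  · intro a
    obtain ⟨hX, hI, i, hi⟩ := h.injectiveHull a
    have := hi.mono
    have := (serreSub L (Set.Iic a)).preservesMonomorphisms_ι_of_isNormalEpiCategory
    have : Mono i.hom := inferInstanceAs (Mono ((serreSub L (Set.Iic a)).ι.map i))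
    exact ⟨i.hom, this, hL.serreSub_cokernel hI (h.multiplicity_one a) i.hom⟩
  · intro a
    obtain ⟨hX, hQ, p, hp⟩ := h.projectiveCover a
    have := hp.epi
    have := (serreSub L (Set.Iic a)).preservesEpimorphisms_ι_of_isNormalMonoCategory
    exact ⟨p.hom, inferInstanceAs (Epi ((serreSub L (Set.Iic a)).ι.map p))⟩
  · exact fun a b hab => hinj a b hab _ (serreSub_of_mem (Set.mem_Iic.2 le_rfl))
  · intro a b e
    obtain ⟨hX, hQ, p, hp⟩ := h.projectiveCover b
    by_cases hab : a < b
    · exact ext_one_eq_zero_of_projective _ hQ hp.projective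
        (serreSub_mono (Set.Iic_subset_Iic.2 hab.le) _ (h.injectiveHull a).2.1) e
    · exact hinj a b hab _ hQ e
  · exact fun a b e => (h.ext_two b a).elim e 0

end Dagger

/-! ### Length, essential epimorphisms and projectives in finite categories -/

section CompositionLength

variable {C : Type u} [Category.{v} C] [Abelian C]

/-- The length of an object: the smallest number of factors in a composition series. -/
noncomputable def compositionLength (X : C) : ℕ :=
  sInf {n | ∃ l, HasCompositionSeries X l ∧ l.length = n}

variable (hfl : ∀ X : C, ∃ l, HasCompositionSeries X l)
include hfl

theorem exists_length_eq_compositionLength (X : C) :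
    ∃ l, HasCompositionSeries X l ∧ l.length = compositionLength X := by
  obtain ⟨l, hl⟩ := hfl X
  exact Nat.sInf_mem (s := {n | ∃ l, HasCompositionSeries X l ∧ l.length = n}) ⟨_, l, hl, rfl⟩

theorem compositionLength_add {S : ShortComplex C} (hS : S.ShortExact) :
    compositionLength S.X₂ = compositionLength S.X₁ + compositionLength S.X₃ := by
  apply le_antisymm
  · obtain ⟨l₁, ⟨h₁, hs₁⟩, e₁⟩ := exists_length_eq_compositionLength hfl S.X₁
    obtain ⟨l₃, ⟨h₃, hs₃⟩, e₃⟩ := exists_length_eq_compositionLength hfl S.X₃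
    exact Nat.sInf_le ⟨l₃ ++ l₁, ⟨h₁.append _ _ _ hS h₃, fun T hT =>
      (List.mem_append.1 hT).elim (hs₃ T) (hs₁ T)⟩, by rw [List.length_append]; omega⟩
  · obtain ⟨l, ⟨h, hs⟩, e⟩ := exists_length_eq_compositionLength hfl S.X₂
    obtain ⟨l₁, l₃, h₁, h₃, hp⟩ := h.exists_perm_of_shortExact hs S.f S.g S.zero hS
    rw [← e, ← hp.length_eq, List.length_append]
    exact add_le_add
      (Nat.sInf_le ⟨l₁, ⟨h₁, fun T hT => hs T (hp.mem_iff.1 (by simp [hT]))⟩, rfl⟩)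
      (Nat.sInf_le ⟨l₃, ⟨h₃, fun T hT => hs T (hp.mem_iff.1 (by simp [hT]))⟩, rfl⟩)

theorem isZero_of_compositionLength_eq_zero {X : C} (h : compositionLength X = 0) : IsZero X := by
  obtain ⟨l, ⟨hl, -⟩, e⟩ := exists_length_eq_compositionLength hfl X
  rw [h, List.length_eq_zero_iff] at e
  subst e
  cases hl with
  | zero _ hX => exact hX

theorem compositionLength_le_of_mono {X Y : C} (f : X ⟶ Y) [Mono f] :
    compositionLength X ≤ compositionLength Y := by
  have := compositionLength_add hfl (S := ShortComplex.mk _ _ (cokernel.condition f))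
    { exact := ShortComplex.exact_cokernel f }
  dsimp at this
  omega

theorem compositionLength_le_of_epi {X Y : C} (f : X ⟶ Y) [Epi f] :
    compositionLength Y ≤ compositionLength X := by
  have := compositionLength_add hfl (S := ShortComplex.mk _ _ (kernel.condition f))
    { exact := ShortComplex.exact_kernel f }
  dsimp at this
  omega

theorem isIso_of_mono_of_compositionLength_le {X Y : C} (f : X ⟶ Y) [Mono f]
    (h : compositionLength Y ≤ compositionLength X) : IsIso f := by
  have := compositionLength_add hfl (S := ShortComplex.mk _ _ (cokernel.condition f))
    { exact := ShortComplex.exact_cokernel f }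
  dsimp at this
  have hz : IsZero (cokernel f) := isZero_of_compositionLength_eq_zero hfl (by omega)
  have : Epi f := Preadditive.epi_of_cokernel_zero (hz.eq_of_tgt _ _)
  exact isIso_of_mono_of_epi f

theorem isIso_of_epi_of_compositionLength_le {X Y : C} (f : X ⟶ Y) [Epi f]
    (h : compositionLength X ≤ compositionLength Y) : IsIso f := by
  have := compositionLength_add hfl (S := ShortComplex.mk _ _ (kernel.condition f))
    { exact := ShortComplex.exact_kernel f }
  dsimp at this
  have hz : IsZero (kernel f) := isZero_of_compositionLength_eq_zero hfl (by omega)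
  have : Mono f := Preadditive.mono_of_kernel_zero (hz.eq_of_src _ _)
  exact isIso_of_mono_of_epi f

end CompositionLength

section EssentialEpi

variable {C : Type u} [Category.{v} C]

/-- An essential epimorphism: an epimorphism `p` such that `g` is an epimorphism whenever
`g ≫ p` is. -/
def IsEssentialEpi {Q X : C} (p : Q ⟶ X) : Prop :=
  Epi p ∧ ∀ ⦃Z : C⦄ (g : Z ⟶ Q), Epi (g ≫ p) → Epi g

theorem IsEssentialEpi.comp {Q X Y : C} {p : Q ⟶ X} {q : X ⟶ Y} (hp : IsEssentialEpi p)
    (hq : IsEssentialEpi q) : IsEssentialEpi (p ≫ q) := by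
  have := hp.1
  have := hq.1
  refine ⟨inferInstance, fun Z g hg => hp.2 g (hq.2 _ ?_)⟩
  rwa [Category.assoc]

end EssentialEpi

section EssentialEpi

variable {C : Type u} [Category.{v} C] [Abelian C]

/-- A subobject of $Z$ of least length among those still mapping onto $X$ works; the induction finds
one by shrinking. -/
theorem exists_isEssentialEpi (hfl : ∀ X : C, ∃ l, HasCompositionSeries X l) {Z X : C} (q : Z ⟶ X)
    [Epi q] : ∃ (W : C) (m : W ⟶ Z), Mono m ∧ IsEssentialEpi (m ≫ q) := by
  induction hn : compositionLength Z using Nat.strong_induction_on generalizing Z with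
  | _ n ih =>
    by_cases hq : IsEssentialEpi q
    · exact ⟨Z, 𝟙 Z, inferInstance, by rwa [Category.id_comp]⟩
    · simp only [IsEssentialEpi, not_and, not_forall] at hq
      obtain ⟨V, g, hg, hg'⟩ := hq inferInstance
      have : Epi (image.ι g ≫ q) := by
        have : Epi (factorThruImage g ≫ image.ι g ≫ q) := by rwa [image.fac_assoc]
        exact epi_of_epi (factorThruImage g) _
      have hlt : compositionLength (image g) < n := by
        by_contra hle
        have := isIso_of_mono_of_compositionLength_le hfl (image.ι g) (by omega)
        exact hg' (by rw [← image.fac g]; infer_instance)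
      obtain ⟨W, m, hm, h⟩ := ih _ hlt (image.ι g ≫ q) rfl
      exact ⟨W, m ≫ image.ι g, inferInstance, by rwa [Category.assoc]⟩

variable {k : Type*} [Field k] [Linear k C] (hfin : ∀ X Y : C, Module.Finite k (X ⟶ Y))

/-- If $f$ were nonzero on $\ker p$, then $\ker p+\ker f=Z$, so $\ker f$ would map onto $S$;
essentiality gives $\ker f=Z$, a contradiction. -/
theorem IsEssentialEpi.exists_fac {Z S T : C} {p : Z ⟶ S} (hp : IsEssentialEpi p) [Simple T]
    (f : Z ⟶ T) : ∃ g : S ⟶ T, p ≫ g = f := by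
  have := hp.1
  have hS : (ShortComplex.mk _ _ (kernel.condition p)).ShortExact :=
    { exact := ShortComplex.exact_kernel p }
  suffices h : kernel.ι p ≫ f = 0 from ⟨hS.exact.desc f h, hS.exact.g_desc f h⟩
  by_contra h
  have : Epi (kernel.ι p ≫ f) := epi_of_nonzero_to_simple h
  have h₁ : Epi (kernel.ι f ≫ p) := by
    rw [epi_iff_surjective_up_to_refinements]
    intro A s
    obtain ⟨A₁, π₁, _, z, hz⟩ := surjective_up_to_refinements_of_epi p s
    obtain ⟨A₂, π₂, _, y, hy⟩ := surjective_up_to_refinements_of_epi (kernel.ι p ≫ f) (z ≫ f)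
    have h₂ : (π₂ ≫ z - y ≫ kernel.ι p) ≫ f = 0 := by
      rw [Preadditive.sub_comp, Category.assoc, Category.assoc, hy, sub_self]
    refine ⟨A₂, π₂ ≫ π₁, inferInstance, kernel.lift f _ h₂, ?_⟩
    rw [kernel.lift_ι_assoc, Preadditive.sub_comp, Category.assoc, Category.assoc, Category.assoc,
      kernel.condition, comp_zero, sub_zero, hz]
  have := hp.2 _ h₁
  rw [zero_of_epi_comp (kernel.ι f) (kernel.condition f), comp_zero] at h
  exact h rfl

include hfin

theorem IsEssentialEpi.finrank_hom_le {Z S : C} {p : Z ⟶ S} (hp : IsEssentialEpi p)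
    {X : C} {l : List C} (h : HasFiltration X l) (hl : ∀ T ∈ l, Simple T) :
    Module.finrank k (Z ⟶ X) ≤ (l.map fun T => Module.finrank k (S ⟶ T)).sum := by
  induction h with
  | zero X hX =>
    have : Subsingleton (Z ⟶ X) := ⟨fun _ _ => hX.eq_of_tgt _ _⟩
    simp [Module.finrank_zero_of_subsingleton]
  | step A hA l _ ih =>
    have := hfin
    have : Simple A.X₃ := hl _ (by simp)
    have h₁ := ih fun T hT => hl T (by simp [hT])
    let φ : (Z ⟶ A.X₂) →ₗ[k] (Z ⟶ A.X₃) := Linear.rightComp k Z A.g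
    have h₂ := φ.finrank_range_add_finrank_ker
    have h₃ : Module.finrank k (LinearMap.range φ) ≤ Module.finrank k (S ⟶ A.X₃) :=
      (Submodule.finrank_le _).trans
        (LinearMap.finrank_le_finrank_of_surjective (f := Linear.leftComp k A.X₃ p) hp.exists_fac)
    have h₄ : Module.finrank k (LinearMap.ker φ) ≤ Module.finrank k (Z ⟶ A.X₁) := by
      have : LinearMap.ker φ ≤ LinearMap.range (Linear.rightComp k Z A.f) := fun f hf => by
        have := hA.mono_f
        exact ⟨hA.exact.lift f hf, hA.exact.lift_f f hf⟩
      exact (Submodule.finrank_mono this).trans (LinearMap.finrank_range_le _)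
    rw [List.map_cons, List.sum_cons]
    omega

end EssentialEpi

section Cogenerated

variable {C : Type u} [Category.{v} C] [Abelian C]

/-- The morphisms from `Z` to `G` are jointly monic. -/
def IsCogeneratedBy (G Z : C) : Prop :=
  ∀ ⦃W : C⦄ (f : W ⟶ Z), (∀ h : Z ⟶ G, f ≫ h = 0) → f = 0

theorem IsCogeneratedBy.of_mono {G Z W : C} (h : IsCogeneratedBy G Z) (m : W ⟶ Z) [Mono m] :
    IsCogeneratedBy G W := fun V f hf =>
  zero_of_comp_mono m (h _ fun g => by rw [Category.assoc, hf])

/-- The morphisms embed $Z$ in a power of $G$; the induction peels off one of them by passing to its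
kernel. -/
theorem compositionLength_le_of_jointly_monic (hfl : ∀ X : C, ∃ l, HasCompositionSeries X l)
    {G Z : C} (gs : List (Z ⟶ G))
    (h : ∀ ⦃W : C⦄ (f : W ⟶ Z), (∀ g ∈ gs, f ≫ g = 0) → f = 0) :
    compositionLength Z ≤ gs.length * compositionLength G := by
  induction hn : gs.length generalizing Z with
  | zero =>
    have hz : IsZero Z := (IsZero.iff_id_eq_zero Z).2 (h _ fun g hg => by simp_all)
    have : HasCompositionSeries Z [] := ⟨.zero _ hz, by simp⟩
    rw [zero_mul]
    exact Nat.sInf_le ⟨[], this, rfl⟩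
  | succ n ih =>
    obtain ⟨g, gs, rfl⟩ := List.exists_cons_of_length_eq_add_one hn
    have h₁ := ih (gs.map (kernel.ι g ≫ ·)) (fun W f hf => by
      refine zero_of_comp_mono (kernel.ι g) (h _ fun g' hg' => ?_)
      rcases List.mem_cons.1 hg' with rfl | hg'
      · rw [Category.assoc, kernel.condition, comp_zero]
      · rw [Category.assoc]
        exact hf _ (List.mem_map.2 ⟨g', hg', rfl⟩)) (by simpa using hn)
    have h₂ := compositionLength_add hfl (S := ShortComplex.mk (kernel.ι g) (factorThruImage g) (by
      rw [← cancel_mono (image.ι g), Category.assoc, image.fac, kernel.condition, zero_comp]))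
      { exact := by
          refine ShortComplex.exact_of_f_is_kernel _ (KernelFork.IsLimit.ofι' _ _
            fun {A} k hk => ?_)
          have hk' : k ≫ g = 0 := by rw [← image.fac g, ← Category.assoc, hk, zero_comp]
          exact ⟨kernel.lift g k hk', kernel.lift_ι _ _ _⟩ }
    have h₃ := compositionLength_le_of_mono hfl (image.ι g)
    dsimp at h₂
    rw [h₂, Nat.add_mul, one_mul]
    omega

/-- Joint monicity stands in for being a subobject of some $G^n$, so this is the class of
subquotients of powers of $G$. -/
theorem isTopologising_quotients_of_cogenerated (G : C) :
    IsTopologising (fun X : C => ∃ (Z : C) (q : Z ⟶ X), Epi q ∧ IsCogeneratedBy G Z) := by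
  let P : ObjectProperty C := fun X : C => ∃ (Z : C) (q : Z ⟶ X), Epi q ∧ IsCogeneratedBy G Z
  have h0 : P.ContainsZero :=
    ⟨_, isZero_zero C, _, 𝟙 _, inferInstance, fun W f _ => (isZero_zero C).eq_of_tgt _ _⟩
  have hq : P.IsClosedUnderQuotients :=
    ⟨fun {X Y} f _ ⟨Z, q, _, hZ⟩ => ⟨Z, q ≫ f, inferInstance, hZ⟩⟩
  have hbin : P.IsClosedUnderBinaryProducts := ⟨by
    rintro X ⟨p⟩
    obtain ⟨Z₁, q₁, _, h₁⟩ := p.prop_diag_obj ⟨WalkingPair.left⟩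
    obtain ⟨Z₂, q₂, _, h₂⟩ := p.prop_diag_obj ⟨WalkingPair.right⟩
    have e := (biprod.isoProd _ _) ≪≫ (HasLimit.isoOfNatIso (diagramIsoPair p.diag)).symm ≪≫
      (limit.isLimit p.diag).conePointUniqueUpToIso p.isLimit
    refine ⟨Z₁ ⊞ Z₂, biprod.map q₁ q₂ ≫ e.hom, inferInstance, fun W f hf => ?_⟩
    apply biprod.hom_ext
    · rw [zero_comp]
      exact h₁ _ fun h => by rw [Category.assoc, hf]
    · rw [zero_comp]
      exact h₂ _ fun h => by rw [Category.assoc, hf]⟩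
  refine ⟨h0, ObjectProperty.IsClosedUnderFiniteProducts.mk', ⟨fun {X Y} f _ ⟨Z, q, _, hZ⟩ => ?_⟩,
    hq⟩
  exact ⟨pullback q f, pullback.snd q f, inferInstance, hZ.of_mono (pullback.fst q f)⟩

/-- In a finite category, every object is a quotient of a projective object. -/
theorem IsFiniteCategory.exists_projective {k : Type*} [Field k] [Linear k C]
    (hC : IsFiniteCategory k C) (S : C) :
    ∃ (Q : C) (p : Q ⟶ S), Projective Q ∧ Epi p := by
  have hfl := hC.finiteLength.finite_length
  have hfin := hC.finiteLength.finite_hom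
  obtain ⟨G, hG⟩ := hC.exists_generator
  obtain ⟨l, hl, hs⟩ := hfl G
  let s : Set ℕ := {n | ∃ (Q : C) (p : Q ⟶ S), IsEssentialEpi p ∧ compositionLength Q = n}
  have hne : s.Nonempty := ⟨_, S, 𝟙 S, ⟨inferInstance, fun Z g hg => by simpa using hg⟩, rfl⟩
  -- An essential cover $Q$ of $S$ is essentially covered by some $W$ cogenerated by $G$. Then $W$
  -- embeds in $G^m$, $m=\dim\mathrm{Hom}(W,G)$, and $m$ is bounded by counting maps from $S$ to the
  -- composition factors of $G$.
  have hbdd : BddAbove s := by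
    refine ⟨(l.map fun T => Module.finrank k (S ⟶ T)).sum * compositionLength G, ?_⟩
    rintro _ ⟨Q, p, hp, rfl⟩
    obtain ⟨Z, q, _, hZ⟩ := hG _ (isTopologising_quotients_of_cogenerated G)
      ⟨G, 𝟙 G, inferInstance, fun W f hf => by simpa using hf (𝟙 G)⟩ Q
    obtain ⟨W, m, _, hm⟩ := exists_isEssentialEpi hfl q
    have := hm.1
    have hW := hZ.of_mono m
    let b := Module.finBasis k (W ⟶ G)
    refine (compositionLength_le_of_epi hfl (m ≫ q)).trans ?_
    refine (compositionLength_le_of_jointly_monic hfl (List.ofFn b)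
      fun V f hf => hW f fun h => ?_).trans (Nat.mul_le_mul_right _ ?_)
    · have hb : Linear.leftComp k G f = 0 := b.ext fun i => hf _ (List.mem_ofFn.2 ⟨i, rfl⟩)
      exact LinearMap.congr_fun hb h
    · rw [List.length_ofFn]
      exact (hm.comp hp).finrank_hom_le hfin hl hs
  -- An essential cover of $S$ of maximal length is projective: an essential cover of $Q$ inside the
  -- pullback is again essential over $S$, hence no longer than $Q$, hence isomorphic to $Q$, which
  -- provides the lift.
  obtain ⟨Q, p, hp, hQ⟩ := Nat.sSup_mem hne hbdd
  refine ⟨Q, p, ⟨fun {E X} f e _ => ?_⟩, hp.1⟩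
  obtain ⟨W, m, _, hm⟩ := exists_isEssentialEpi hfl (pullback.fst f e)
  have := hm.1
  have hle : compositionLength W ≤ compositionLength Q := by
    rw [hQ]
    exact le_csSup hbdd ⟨W, _, hm.comp hp, rfl⟩
  have := isIso_of_epi_of_compositionLength_le hfl (m ≫ pullback.fst f e) hle
  refine ⟨inv (m ≫ pullback.fst f e) ≫ m ≫ pullback.snd f e, ?_⟩
  rw [Category.assoc, IsIso.inv_comp_eq, Category.assoc, Category.assoc, pullback.condition]

end Cogenerated

/-! ### Morphisms from objects of $\mathbf{C}$ to ind-objects -/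

section IndObjects

open Opposite
variable {C : Type u} [Category.{v} C]

/-- Objects of $\mathbf{C}$ are compact in the ind-completion: evaluating presheaves at $M$
preserves the filtered colimit, and Yoneda turns an element at stage $j$ into the factorization. -/
theorem exists_fac_of_isColimit {J : Type v} [SmallCategory J] [IsFiltered J] {F : J ⥤ C}
    {I : Ind C} {s : F ⋙ Ind.yoneda ⟶ (Functor.const J).obj I} (hs : IsColimit (Cocone.mk I s))
    {M : C} (g : Ind.yoneda.obj M ⟶ I) :
    ∃ (j : J) (g' : M ⟶ F.obj j), Ind.yoneda.map g' ≫ s.app j = g := by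
  let E := Ind.inclusion C ⋙ (evaluation _ (Type v)).obj (op M)
  have hE := isColimitOfPreserves E hs
  let a := Ind.yonedaCompInclusion (C := C)
  let x₀ : E.obj (Ind.yoneda.obj M) := (a.inv.app M).app (op M) (𝟙 M)
  obtain ⟨j, y, hy⟩ := Types.jointly_surjective _ hE (E.map g x₀)
  refine ⟨j, (a.hom.app (F.obj j)).app (op M) y, ?_⟩
  apply (Ind.inclusion C).map_injective
  rw [← cancel_epi (a.inv.app M)]
  apply yonedaEquiv.injective
  have h₁ := a.inv.naturality ((a.hom.app (F.obj j)).app (op M) y)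
  have h₂ := a.hom_inv_id_app (F.obj j)
  rw [Functor.map_comp]
  rw [yonedaEquiv_apply, yonedaEquiv_apply]
  have h₃ := congrArg (fun φ => φ.app (op M) (𝟙 M)) h₁
  have h₄ := congrArg (fun φ => φ.app (op M) y) h₂
  dsimp at h₃ h₄ hy ⊢
  rw [Category.id_comp, h₄] at h₃
  rw [← h₃]
  exact hy

/-- Finitely many morphisms to a directed union of subobjects which belong to `C` factor through a
member of the union. -/
theorem IsUnionOfFlagsAbove.exists_fac [Abelian C] {Λ : Type t} [PartialOrder Λ] {N : Λ → C} {a : Λ}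
    {I : Ind C} (h : IsUnionOfFlagsAbove N a I) {M₁ M₂ : C} (g₁ : Ind.yoneda.obj M₁ ⟶ I)
    (g₂ : Ind.yoneda.obj M₂ ⟶ I) :
    ∃ (X : C) (σ : Ind.yoneda.obj X ⟶ I) (f₁ : M₁ ⟶ X) (f₂ : M₂ ⟶ X), Mono σ ∧
      HasFlagAbove N a X ∧ Ind.yoneda.map f₁ ≫ σ = g₁ ∧ Ind.yoneda.map f₂ ≫ σ = g₂ := by
  obtain ⟨J, _, _, _, F, s, ⟨hs⟩, hmono, hflag⟩ := h
  obtain ⟨j₁, f₁, rfl⟩ := exists_fac_of_isColimit hs g₁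
  obtain ⟨j₂, f₂, rfl⟩ := exists_fac_of_isColimit hs g₂
  obtain ⟨j, h₁, h₂⟩ := exists_ge_ge j₁ j₂
  have hn : ∀ {i : J} (hij : i ≤ j), Ind.yoneda.map (F.map (homOfLE hij)) ≫ s.app j = s.app i :=
    fun hij => (s.naturality (homOfLE hij)).trans (Category.comp_id _)
  refine ⟨F.obj j, s.app j, f₁ ≫ F.map (homOfLE h₁), f₂ ≫ F.map (homOfLE h₂), hmono j, hflag j,
    ?_, ?_⟩
  · rw [Functor.map_comp, Category.assoc, hn h₁]
  · rw [Functor.map_comp, Category.assoc, hn h₂]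

theorem yoneda_map_comp_injective {I : Ind C} {A B : C} (σ : Ind.yoneda.obj B ⟶ I) [Mono σ]
    {f g : A ⟶ B} (h : Ind.yoneda.map f ≫ σ = Ind.yoneda.map g ≫ σ) : f = g :=
  Ind.yoneda.map_injective ((cancel_mono σ).1 h)

theorem exists_extension_of_injective {I : Ind C} (hI : Injective I) {A B : C} (f : A ⟶ B) [Mono f]
    (g : Ind.yoneda.obj A ⟶ I) : ∃ h : Ind.yoneda.obj B ⟶ I, Ind.yoneda.map f ≫ h = g :=
  ⟨Injective.factorThru g (Ind.yoneda.map f), Injective.comp_factorThru _ _⟩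

variable [Abelian C]

theorem mono_of_mono_yoneda_comp {I : Ind C} {A B : C} (f : A ⟶ B) (σ : Ind.yoneda.obj B ⟶ I)
    [h : Mono (Ind.yoneda.map f ≫ σ)] : Mono f :=
  have := mono_of_mono (Ind.yoneda.map f) σ
  Ind.yoneda.mono_of_mono_map this

/-- Objects of $\mathbf{C}$ lying between $X$ and its ind-hull are essential extensions of $X$,
tested within $\mathbf{C}$. -/
theorem IsInjectiveHull.essential_of_mono {I : Ind C} {X Y : C} {τ : X ⟶ Y}
    {σ : Ind.yoneda.obj Y ⟶ I} [Mono σ] (h : IsInjectiveHull (Ind.yoneda.map τ ≫ σ)) {Z : C}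
    (g : Y ⟶ Z) (hg : Mono (τ ≫ g)) : Mono g := by
  obtain ⟨φ, hφ⟩ := exists_extension_of_injective h.injective (τ ≫ g) (Ind.yoneda.map τ ≫ σ)
  have := h.injective
  let ψ := Injective.factorThru (Ind.yoneda.map g ≫ φ) σ
  have hψ : σ ≫ ψ = Ind.yoneda.map g ≫ φ := Injective.comp_factorThru _ _
  have : Mono ψ := by
    refine h.essential ψ ?_
    rw [Category.assoc, hψ, ← Category.assoc, ← Functor.map_comp, hφ]
    exact h.mono
  have : Mono (Ind.yoneda.map g ≫ φ) := hψ ▸ inferInstance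
  exact mono_of_mono_yoneda_comp g φ

theorem IsInjectiveHull.nonempty_iso_of_simple {Λ : Type t} [PartialOrder Λ] {N : Λ → C} {a : Λ}
    {I : Ind C} (h : IsUnionOfFlagsAbove N a I) {X W : C} [Simple X] [Simple W]
    {i : Ind.yoneda.obj X ⟶ I} (hi : IsInjectiveHull i) (m : Ind.yoneda.obj W ⟶ I) [Mono m] :
    Nonempty (W ≅ X) := by
  obtain ⟨Y, σ, τ, f, _, -, rfl, rfl⟩ := h.exists_fac i m
  have := hi.mono
  have := mono_of_mono_yoneda_comp f σ
  have := mono_of_mono_yoneda_comp τ σ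
  have hz : τ ≫ cokernel.π f = 0 := by
    by_contra hne
    have := hi.essential_of_mono (cokernel.π f)
      (Preadditive.mono_of_kernel_zero (kernel_zero_of_nonzero_from_simple hne))
    have hf : f = 0 := zero_of_comp_mono (cokernel.π f) (cokernel.condition f)
    exact Simple.not_isZero W (IsZero.of_mono_eq_zero f hf)
  have hS : (ShortComplex.mk _ _ (cokernel.condition f)).ShortExact :=
    { exact := ShortComplex.exact_cokernel f }
  let t : X ⟶ W := hS.exact.lift τ hz
  have ht : t ≫ f = τ := hS.exact.lift_f τ hz
  have : IsIso t := isIso_of_simple_of_ne_zero t fun h0 => by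
    rw [h0, zero_comp] at ht
    exact Simple.not_isZero X (IsZero.of_mono_eq_zero τ ht.symm)
  exact ⟨(asIso t).symm⟩

end IndObjects

/-! ### Version $\ast$ -/

section Star

open Abelian
variable {C : Type u} [Category.{v} C] [Abelian C] {Λ : Type t} [PartialOrder Λ] {L N : Λ → C}
  {I : Λ → Ind C}

theorem HasFlagAbove.prop_of_forall {a : Λ} {X : C} (h : HasFlagAbove N a X) (Q : C → Prop)
    (hzero : ∀ X, IsZero X → Q X)
    (hext : ∀ S : ShortComplex C, S.ShortExact → Q S.X₁ → Q S.X₃ → Q S.X₂)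
    (hiso : ∀ X Y, (X ≅ Y) → Q X → Q Y) (hN : ∀ b, a ≤ b → Q (N b)) : Q X := by
  obtain ⟨l, h, hl⟩ := h
  induction h with
  | zero X hX => exact hzero X hX
  | step S hS l _ ih =>
    obtain ⟨b, hb, ⟨e⟩⟩ := hl S.X₃ (by simp)
    exact hext S hS (ih fun T hT => hl T (by simp [hT])) (hiso _ _ e.symm (hN b hb))

variable {k : Type*} [Field k] [Linear k C]

theorem IsLFHWStarWith.exists_coreflection (h : IsLFHWStarWith k L N I) (a : Λ) :
    ∃ (i : L a ⟶ N a) (j : Ind.yoneda.obj (N a) ⟶ I a), Mono i ∧ Mono j ∧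
      IsInjectiveHull (Ind.yoneda.map i ≫ j) ∧
      ∀ M, serreSub L (Set.Iic a) M → ∀ g : Ind.yoneda.obj M ⟶ I a,
        ∃ f : M ⟶ N a, Ind.yoneda.map f ≫ j = g := by
  obtain ⟨i', hi'⟩ := h.injectiveHull a
  obtain ⟨hN, j, hj⟩ := h.gamma a
  obtain ⟨i, rfl⟩ := (hj (L a) (serreSub_of_mem (Set.mem_Iic.2 le_rfl))).2 i'
  obtain ⟨X, σ, q, -, _, -, rfl, -⟩ := (h.union_of_flags a).exists_fac j j
  -- The kernel of $q$ lies in $\mathbf{C}_{\le a}$ and is killed in $I(a)$, so uniqueness in the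
  -- coreflection makes it zero.
  have : Mono q := by
    refine Preadditive.mono_of_kernel_zero ?_
    refine (hj _ ((serreSub L _).prop_of_mono (kernel.ι q) hN)).1 ?_
    dsimp
    rw [← Category.assoc, ← Functor.map_comp, kernel.condition, ← Category.assoc,
      ← Functor.map_comp, zero_comp]
  have : Mono (Ind.yoneda.map i ≫ Ind.yoneda.map q ≫ σ) := hi'.mono
  exact ⟨i, _, mono_of_mono_yoneda_comp i (Ind.yoneda.map q ≫ σ), inferInstance, hi',
    fun M hM g => (hj M hM).2 g⟩

/-- The lowest nonzero layer of a flag inside $I(a)$ is some $\nabla(b)$; its simple subobject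
$L(b)$ lies in $I(a)$, forcing $b=a$. Comparing lengths, this layer is the coreflection $\nabla(a)$
itself. -/
theorem IsLFHWStarWith.isZero_or_exists_fac (hfl : ∀ X : C, ∃ l, HasCompositionSeries X l)
    (hL : LabelsSimples L) (h : IsLFHWStarWith k L N I) {a : Λ} {i : L a ⟶ N a}
    {j : Ind.yoneda.obj (N a) ⟶ I a} (hi : IsInjectiveHull (Ind.yoneda.map i ≫ j))
    (hj : ∀ M, serreSub L (Set.Iic a) M → ∀ g : Ind.yoneda.obj M ⟶ I a,
        ∃ f : M ⟶ N a, Ind.yoneda.map f ≫ j = g) {X : C} (hX : HasFlagAbove N a X)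
    (σ : Ind.yoneda.obj X ⟶ I a) [Mono σ] :
    IsZero X ∨ ∃ t : N a ⟶ X, Mono t ∧ Ind.yoneda.map t ≫ σ = j ∧
      HasFlagAbove N a (cokernel t) := by
  obtain ⟨l, hX, hl⟩ := hX
  induction hX with
  | zero X hX => exact Or.inl hX
  | step S hS l _ ih =>
    right
    have := hS.mono_f
    have := hS.epi_g
    obtain ⟨b, hb, ⟨e⟩⟩ := hl S.X₃ (by simp)
    rcases ih (Ind.yoneda.map S.f ≫ σ) (fun T hT => hl T (by simp [hT])) with
      hz | ⟨t₁, ht₁, hσ, l', hl', hlN⟩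
    · have : IsIso S.g := by
        have : Mono S.g := hS.exact.mono_g (hz.eq_of_src _ _)
        exact isIso_of_mono_of_epi S.g
      obtain ⟨i', -, hi', -⟩ := h.exists_coreflection b
      have := hL.simple a
      have := hL.simple b
      obtain rfl : b = a := hL.eq_of_iso b a
        (hi.nonempty_iso_of_simple (h.union_of_flags a)
          (Ind.yoneda.map (i' ≫ e.inv ≫ inv S.g) ≫ σ))
      obtain ⟨s, hs⟩ := hj S.X₂ ((serreSub L _).prop_of_iso (asIso S.g ≪≫ e).symm (h.gamma b).1) σ
      have : Mono (Ind.yoneda.map s ≫ j) := hs ▸ inferInstance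
      have : Mono s := mono_of_mono_yoneda_comp s j
      have : IsIso s := isIso_of_mono_of_compositionLength_le hfl s
        (compositionLength_le_of_mono hfl (e.inv ≫ inv S.g))
      refine ⟨inv s, inferInstance, ?_, [], .zero _ (isZero_cokernel_of_epi _), by simp⟩
      rw [← hs, ← Category.assoc, ← Functor.map_comp, IsIso.inv_hom_id,
        CategoryTheory.Functor.map_id, Category.id_comp]
    · refine ⟨t₁ ≫ S.f, inferInstance, by rw [Functor.map_comp, Category.assoc, hσ],
        S.X₃ :: l', ?_, fun T hT => ?_⟩
      · obtain ⟨p, q, hpq, hU⟩ := exists_shortExact_cokernel hS t₁ (cokernel.π (t₁ ≫ S.f)) rfl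
          (cokernel.condition _) { exact := ShortComplex.exact_cokernel _ }
        exact .step _ hU _ hl'
      · rcases List.mem_cons.1 hT with rfl | hT
        exacts [⟨b, hb, ⟨e⟩⟩, hlN T hT]

/-- A morphism from an object of `C` to the injective hull factors through an object which contains
the costandard object, with a quotient filtered by costandard objects. -/
theorem IsLFHWStarWith.exists_fac (hfl : ∀ X : C, ∃ l, HasCompositionSeries X l)
    (hL : LabelsSimples L) (h : IsLFHWStarWith k L N I) {a : Λ} {i : L a ⟶ N a} [Mono i]
    {j : Ind.yoneda.obj (N a) ⟶ I a} (hi : IsInjectiveHull (Ind.yoneda.map i ≫ j))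
    (hj : ∀ M, serreSub L (Set.Iic a) M → ∀ g : Ind.yoneda.obj M ⟶ I a,
        ∃ f : M ⟶ N a, Ind.yoneda.map f ≫ j = g) [Mono j] {E : C} (u : N a ⟶ E) [Mono u] :
    ∃ (X : C) (f : E ⟶ X), Mono (u ≫ f) ∧ HasFlagAbove N a (cokernel (u ≫ f)) := by
  obtain ⟨g, hg⟩ := exists_extension_of_injective hi.injective u j
  obtain ⟨X, σ, f, -, _, hX, rfl, -⟩ := (h.union_of_flags a).exists_fac g g
  have : Mono (Ind.yoneda.map (u ≫ f) ≫ σ) := by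
    rw [Functor.map_comp, Category.assoc, hg]
    infer_instance
  have : Mono (u ≫ f) := mono_of_mono_yoneda_comp (u ≫ f) σ
  rcases h.isZero_or_exists_fac hfl hL hi hj hX σ with hz | ⟨t, ht, hσ, hflag⟩
  · have := hL.simple a
    exact (Simple.not_isZero (L a) (hz.of_mono (i ≫ u ≫ f))).elim
  · have htf : t = u ≫ f := yoneda_map_comp_injective σ (by
      rw [hσ, Functor.map_comp, Category.assoc, hg])
    subst htf
    exact ⟨X, f, ht, hflag⟩

/-- A nonzero image in $\nabla(b)$ would contain the essential subobject $L(b)$, whose weight is not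
in $\Omega$. -/
theorem IsLFHWStarWith.hom_eq_zero (hL : LabelsSimples L) (h : IsLFHWStarWith k L N I)
    {Ω : Set Λ} {b : Λ} (hb : b ∉ Ω) {M : C} (hM : serreSub L Ω M) (f : M ⟶ N b) : f = 0 := by
  obtain ⟨i, j, _, _, hi, -⟩ := h.exists_coreflection b
  have := hL.simple b
  by_cases hz : i ≫ cokernel.π f = 0
  · let m : L b ⟶ Abelian.image f := kernel.lift (cokernel.π f) i hz
    have hm : m ≫ Abelian.image.ι f = i := kernel.lift_ι _ _ _
    have : Mono m := mono_of_mono_fac hm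
    exact (hb (hL.mem_of_serreSub ((serreSub L Ω).prop_of_mono m
      ((serreSub L Ω).prop_of_epi (Abelian.factorThruImage f) hM)))).elim
  · have := hi.essential_of_mono (cokernel.π f)
      (Preadditive.mono_of_kernel_zero (kernel_zero_of_nonzero_from_simple hz))
    exact zero_of_comp_mono (cokernel.π f) (cokernel.condition f)

variable [HasExt.{w} C]

/-- Map an extension $E$ of $M$ by $\nabla(a)$ to a flagged $X\supseteq\nabla(a)$. The induced map
$M\to X/\nabla(a)$ vanishes, as the layers $\nabla(b)$, $b\ge a$, receive no maps from $M$; so $E$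
lands in $\nabla(a)$, which splits the extension. -/
theorem IsLFHWStarWith.ext_one_eq_zero (hfl : ∀ X : C, ∃ l, HasCompositionSeries X l)
    (hL : LabelsSimples L) (h : IsLFHWStarWith k L N I) {Ω : Set Λ} (hΩ : IsLowerSet Ω) {a : Λ}
    (ha : a ∉ Ω) {M : C} (hM : serreSub L Ω M) (e : Ext.{w} M (N a) 1) : e = 0 := by
  obtain ⟨i, j, _, _, hi, hj⟩ := h.exists_coreflection a
  refine ext_one_eq_zero_of_retraction (fun E f g z hE => ?_) e
  have : Mono f := hE.mono_f
  have := hE.epi_g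
  obtain ⟨X, s, hs, hX⟩ := h.exists_fac hfl hL hi hj f
  have hS : (ShortComplex.mk _ _ (cokernel.condition (f ≫ s))).ShortExact :=
    { exact := ShortComplex.exact_cokernel _ }
  have hm : hE.exact.desc (s ≫ cokernel.π (f ≫ s))
      (by rw [← Category.assoc, cokernel.condition]) = 0 := by
    refine hX.prop_of_forall (fun X => ∀ f : M ⟶ X, f = 0) (fun X hX f => hX.eq_of_tgt _ _)
      (fun S hS h₁ h₃ f => ?_) (fun X Y e hX f => ?_)
      (fun b hb f => h.hom_eq_zero hL (fun hb' => ha (hΩ hb hb')) hM f) _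
    · have := hS.mono_f
      rw [← hS.exact.lift_f f (h₃ _), h₁ (hS.exact.lift f (h₃ _)), zero_comp]
    · exact zero_of_comp_mono e.inv (hX _)
  have hz : s ≫ cokernel.π (f ≫ s) = 0 := by
    rw [← hE.exact.g_desc (s ≫ cokernel.π (f ≫ s)) (by rw [← Category.assoc, cokernel.condition]),
      hm, comp_zero]
  refine ⟨hS.exact.lift s hz, ?_⟩
  rw [← cancel_mono (f ≫ s), Category.assoc, Category.id_comp]
  exact congrArg (f ≫ ·) (hS.exact.lift_f s hz)

theorem IsLFHWStarWith.ext_one_eq_zero_of_le (h : IsLFHWStarWith k L N I) {a : Λ} {M : C}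
    (hM : serreSub L (Set.Iic a) M) (e : Ext.{w} M (N a) 1) : e = 0 := by
  obtain ⟨i, j, _, _, hi, hj⟩ := h.exists_coreflection a
  refine ext_one_eq_zero_of_retraction (fun E f g z hE => ?_) e
  have : Mono f := hE.mono_f
  obtain ⟨g', hg'⟩ := exists_extension_of_injective hi.injective f j
  obtain ⟨r, rfl⟩ := hj E ((serreSub L _).prop_X₂_of_shortExact hE (h.gamma a).1 hM) g'
  refine ⟨r, yoneda_map_comp_injective j ?_⟩
  rw [Functor.map_comp, Category.assoc, hg', CategoryTheory.Functor.map_id, Category.id_comp]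

theorem IsLFHWStarWith.exists_standardData (hfl : ∀ X : C, ∃ l, HasCompositionSeries X l)
    (hL : LabelsSimples L) (h : IsLFHWStarWith k L N I) :
    ∃ D : Λ → C, StandardData.{w} L N D := by
  have hproj : ∀ a, ∃ (D : C) (hD : serreSub L (Set.Iic a) D) (p : D ⟶ L a), Epi p ∧
      Projective (⟨D, hD⟩ : (serreSub L (Set.Iic a)).FullSubcategory) := fun a => by
    obtain ⟨Q, p, hQ, hp⟩ := (h.finite a).exists_projective
      ⟨L a, serreSub_of_mem (Set.mem_Iic.2 le_rfl)⟩
    have := (serreSub L (Set.Iic a)).preservesEpimorphisms_ι_of_isNormalMonoCategory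
    exact ⟨Q.obj, Q.property, p.hom, inferInstanceAs (Epi ((serreSub L (Set.Iic a)).ι.map p)), hQ⟩
  choose D hD p hp hDp using hproj
  have hone : ∀ a b, ∀ e : Ext.{w} (D b) (N a) 1, e = 0 := fun a b e => by
    by_cases hab : a ≤ b
    · exact ext_one_eq_zero_of_projective _ (hD b) (hDp b)
        (serreSub_mono (Set.Iic_subset_Iic.2 hab) _ (h.gamma a).1) e
    · exact h.ext_one_eq_zero hfl hL (isLowerSet_Iic b) hab (hD b) e
  refine ⟨D, fun a => (h.gamma a).1, hD, fun a => ?_, fun a => ⟨p a, hp a⟩, fun a b hab e => ?_,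
    hone, fun a b e => ?_⟩
  · obtain ⟨i, -, hi, -⟩ := h.exists_coreflection a
    exact ⟨i, hi, hL.serreSub_cokernel (h.gamma a).1 (h.multiplicity_one a) i⟩
  · by_cases hle : a ≤ b
    · obtain rfl := hle.eq_of_not_lt hab
      exact h.ext_one_eq_zero_of_le (serreSub_of_mem (Set.mem_Iic.2 le_rfl)) e
    · exact h.ext_one_eq_zero hfl hL (isLowerSet_Iic b) hle
        (serreSub_of_mem (Set.mem_Iic.2 le_rfl)) e
  · obtain ⟨i, j, _, _, hi, hj⟩ := h.exists_coreflection a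
    -- For second extensions: the class dies in some $Z\supseteq\nabla(a)$, hence in a flagged
    -- $X\supseteq\nabla(a)$ receiving $Z$. It then comes from
    -- $\mathrm{Ext}^1(\Delta(b),X/\nabla(a))$, zero by induction over the flag.
    obtain ⟨Z, u, _, hu⟩ := exists_mono_comp_mk₀_eq_zero e
    obtain ⟨X, s, _, hX⟩ := h.exists_fac hfl hL hi hj u
    have hS : (ShortComplex.mk _ _ (cokernel.condition (u ≫ s))).ShortExact :=
      { exact := ShortComplex.exact_cokernel _ }
    obtain ⟨x, rfl⟩ := Ext.covariant_sequence_exact₁ (D b) hS e (by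
      dsimp
      rw [← Ext.mk₀_comp_mk₀, ← Ext.comp_assoc_of_second_deg_zero, hu, Ext.zero_comp])
      (n₀ := 1) rfl
    have hx : x = 0 := by
      refine hX.prop_of_forall (fun X => ∀ e : Ext.{w} (D b) X 1, e = 0) (fun X hX e => ?_)
        (fun S hS h₁ h₃ => ext_eq_zero_of_shortExact_right hS h₁ h₃) (fun X Y i hX e => ?_)
        (fun c _ => hone c b) x
      · rw [← Ext.comp_mk₀_id e, hX.eq_of_src (𝟙 X) 0, Ext.mk₀_zero, Ext.comp_zero]
      · rw [← Ext.comp_mk₀_id e, ← i.inv_hom_id, ← Ext.mk₀_comp_mk₀,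
          ← Ext.comp_assoc_of_second_deg_zero, hX (e.comp _ _), Ext.zero_comp]
    rw [hx, Ext.zero_comp]

end Star

end HWCat

theorem mainTheorem12 (k : Type*) [Field k] [IsAlgClosed k]
    (C : Type u) [Category.{v} C] [Abelian C] [Linear k C]
    (hC : HWCat.IsFiniteLengthCategory k C)
    (Λ : Type w) [PartialOrder Λ] (L : Λ → C) (hL : HWCat.LabelsSimples L)
    (hLFHW : HWCat.IsLFHW k L)
    (Ω : Set Λ) (hfin : Ω.Finite) (hideal : IsLowerSet Ω) :
    HWCat.ExtensionFull (HWCat.serreSub L Ω) := by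
  let := HasExt.standard C
  rcases hLFHW.conditions with ⟨N, I, h⟩ | ⟨N, D, h⟩
  · obtain ⟨D, hd⟩ := h.exists_standardData hC.finite_length hL
    exact hd.extensionFull k hC hL hLFHW.lowerFinite hideal hfin
  · exact (h.standardData hL hLFHW.lowerFinite).extensionFull k hC hL hLFHW.lowerFinite hideal hfin
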